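/- Let $N\in\mathbb N$, let $A\in M_N(\mathbb N)$ (entries may be $0$) and $B\in M_N(\{0,1\})$ with $A_{ij}=0\Rightarrow B_{ij}=0$. Let $E_A$ be the directed graph with vertices $1,\dots,N$ and edges $e_{i,j,m}$, $0\le m<A_{ij}$, with range $r(e_{i,j,m})=i$ and source $s(e_{i,j,m})=j$. A path $e_1e_2\cdots$ satisfies $s(e_t)=r(e_{t+1})$. For $k\in\mathbb Z$ put $a_i^k\cdot e_{i,j,m}=e_{i,j,\hat m}$ and $a_i^k|_{e_{i,j,m}}=a_j^{\hat k}$, where $kB_{ij}+m=\hat kA_{ij}+\hat m$, $0\le \hat m<A_{ij}$, and extend to finite paths by $g\cdot(e\mu)=(g\cdot e)(g|_e\cdot\mu)$ and $g|_{e\mu}=(g|_e)|_\mu$. Let $G_B$ be the group bundle over $\{1,\dots,N\}$ obtained by dividing, for each $i$, the group $\{a_i^k: k\in\mathbb Z\}$ by the kernel of its action on the finite paths with range $i$. Assume that $(G_B,E_A)$ is regular: for every $g\in G_B$ there is $K$ such that $g\cdot\mu=\mu$ and $|\mu|\ge K$ imply that $g|_\mu$ is a unit of $G_B$. Let $E_A^{-\infty}$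 be the space of left-infinite paths $\mu=\dots\mu_{-2}\mu_{-1}$ (product topology), with the shift $\sigma(\dots\mu_{-2}\mu_{-1})=\dots\mu_{-3}\mu_{-2}$. Write $\mu\sim_{ae}\nu$ if there are a finite set $F\subseteq G_B$ and $g_n\in F$ $(n<0)$, with $g_n$ in the group over $r(\mu_n)$, such that $g_n\cdot\mu_n\cdots\mu_{-1}=\nu_n\cdots\nu_{-1}$ for all $n<0$. Let $\mathcal J=E_A^{-\infty}/{\sim_{ae}}$ be the limit space with the quotient topology, $q$ the quotient map and $\tilde\sigma$ the map induced by $\sigma$. Let $C_{ij}=1$ if $A_{ij}\ne0$ and $C_{ij}=0$ otherwise, and let $E_C^{-\infty}$ be the space of sequences $v=\dots v_{-2}v_{-1}$ of vertices with $C_{v_{k-1},v_k}=1$ for all $k<0$, with its shift $\sigma$. Define $\pi:E_A^{-\infty}\to E_C^{-\infty}$ by $\pi(\mu)_k=s(\mu_k)$ and let $\pi_{\mathcal J}:\mathcal J\to E_C^{-\infty}$ be the induced map. For $v\in E_C^{-\infty}$ set $A_{v[k,-1]}=\prod_{j=k}^{-1}A_{v_{j-1},v_j}$ and $K(v)=-\min\{k<0: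 B_{v_{k-1},v_k}=0\}\in\mathbb N\cup\{\infty\}$, with $K(v)=0$ if this set is empty and $K(v)=\infty$ if it is infinite. Then: Every connected component of $\mathcal J$ is a point or is homeomorphic to a circle. The maps $\pi$ and $\pi_{\mathcal J}$ are factor maps, i.e. continuous surjections with $\pi\circ\sigma=\sigma\circ\pi$ and $\pi_{\mathcal J}\circ\tilde\sigma=\sigma\circ\pi_{\mathcal J}$. Moreover, for $v\in E_C^{-\infty}$: 1. If $K(v)=\infty$, then $q$ restricts to a homeomorphism $\pi^{-1}(v)\simeq\pi_{\mathcal J}^{-1}(v)$. Moreover $K(\sigma(v))=\infty$, and under these identifications $\tilde\sigma$ is the shift $\sigma:\pi^{-1}(v)\to\pi^{-1}(\sigma(v))$. 2. If $K(v)=0$ and $\max_{k<0}A_{v[k,-1]}=\infty$, then there is a homeomorphism $h_v:\pi_{\mathcal J}^{-1}(v)\to\mathbb T=\{z\in\mathbb C:|z|=1\}$ given by $h_v(q(\mu))=\exp\bigl(2\pi i\sum_{k<0} i_k/A_{v[k,-1]}\bigr)$, where $i_k$ is the label of $\mu_k=e_{v_{k-1},v_k,i_k}$. The path $\sigma(v)$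 satisfies the same two conditions, and $h_{\sigma(v)}(\tilde\sigma(z))=h_v(z)^n$ with $n=A_{v_{-2},v_{-1}}$. 3. If $K(v)=0$ and $\max_{k<0}A_{v[k,-1]}<\infty$, then $\pi^{-1}(v)$ and $\pi_{\mathcal J}^{-1}(v)$ are single points. 4. If $K=K(v)$ satisfies $0<K<\infty$, then $K(\sigma^{K}(v))=0$ (so that 2 or 3 describes $\pi_{\mathcal J}^{-1}(\sigma^K(v))$), and $q(\mu)\mapsto(q(\sigma^K(\mu)),\ \mu_{-K}\cdots\mu_{-1})$ is a homeomorphism $\pi_{\mathcal J}^{-1}(v)\simeq\pi_{\mathcal J}^{-1}(\sigma^{K}(v))\times\pi^{-1}(v_{-K-1}\cdots v_{-1})$, where $\pi^{-1}(v_{-K-1}\cdots v_{-1})$ is the finite discrete set of paths $\mu_{-K}\cdots\mu_{-1}$ in $E_A$ with $r(\mu_k)=v_{k-1}$ and $s(\mu_k)=v_k$. Moreover $K(\sigma(v))=K-1$, and under these identifications $\tilde\sigma:\pi_{\mathcal J}^{-1}(v)\to\pi_{\mathcal J}^{-1}(\sigma(v))$ is $\mathrm{id}\times\sigma$, where $\sigma(\mu_{-K}\cdots\mu_{-1})=\mu_{-K}\cdots\mu_{-2}$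 (for $K=1$ the second factor of the target is a point, and the target is identified with $\pi_{\mathcal J}^{-1}(\sigma(v))$ itself). -/

import Mathlib

/-- `(A, B)` is a Katsura pair: `A` has entries in `ℕ`, `B` has entries in `ℤ`, and
`A i j = 0` implies `B i j = 0`. -/
def IsKatsuraPair {N : ℕ} (A : Matrix (Fin N) (Fin N) ℕ) (B : Matrix (Fin N) (Fin N) ℤ) : Prop :=
  ∀ i j, A i j = 0 → B i j = 0

namespace KEP

/-- The edges `e_{i,j,m}`, `0 ≤ m < A i j`, of the graph `E_A` with vertex set `Fin N`; here
`i` is the range, `j` the source and `m` the label. -/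
@[ext]
structure Edge {N : ℕ} (A : Matrix (Fin N) (Fin N) ℕ) where
  rng : Fin N
  src : Fin N
  lbl : Fin (A rng src)

/-- The edge set carries the discrete topology. -/
instance {N : ℕ} (A : Matrix (Fin N) (Fin N) ℕ) : TopologicalSpace (Edge A) := ⊥

/-! ### Finite paths -/

/-- `e₁ … eₙ` is a path with range `i`, i.e. `r(e₁) = i` and `s(e_t) = r(e_{t+1})`. The empty
list stands for the vertex `i`. -/
def IsPath {N : ℕ} {A : Matrix (Fin N) (Fin N) ℕ} : Fin N → List (Edge A) → Prop
  | _, [] => True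
  | i, e :: μ => e.rng = i ∧ IsPath e.src μ

/-- The source of a path with range `i`. -/
def pathSrc {N : ℕ} {A : Matrix (Fin N) (Fin N) ℕ} : Fin N → List (Edge A) → Fin N
  | i, [] => i
  | _, e :: μ => pathSrc e.src μ

/-- The set `i E_A^*` of finite paths with range `i`. -/
abbrev PathFrom {N : ℕ} (A : Matrix (Fin N) (Fin N) ℕ) (i : Fin N) : Type :=
  {μ : List (Edge A) // IsPath i μ}

/-! ### The Katsura-Exel-Pardo action -/

/-- For `kB + m = k'A + m'` with `0 ≤ m' < A`, the edge `aᵏ · e_{i,j,m} = e_{i,j,m'}`. -/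
def actEdge {N : ℕ} {A : Matrix (Fin N) (Fin N) ℕ} (B : Matrix (Fin N) (Fin N) ℤ) (k : ℤ)
    (e : Edge A) : Edge A where
  rng := e.rng
  src := e.src
  lbl := ⟨((k * B e.rng e.src + (e.lbl.val : ℤ)) % (A e.rng e.src : ℤ)).toNat, by
    have h : (0 : ℤ) < (A e.rng e.src : ℤ) := by
      have := e.lbl.isLt
      omega
    have h1 := Int.emod_nonneg (k * B e.rng e.src + (e.lbl.val : ℤ)) h.ne'
    have h2 := Int.emod_lt_of_pos (k * B e.rng e.src + (e.lbl.val : ℤ)) h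
    omega⟩

/-- For `kB + m = k'A + m'` with `0 ≤ m' < A`, the exponent `k'` of the restriction
`aᵏ|_{e_{i,j,m}}`. -/
def resEdge {N : ℕ} {A : Matrix (Fin N) (Fin N) ℕ} (B : Matrix (Fin N) (Fin N) ℤ) (k : ℤ)
    (e : Edge A) : ℤ :=
  (k * B e.rng e.src + (e.lbl.val : ℤ)) / (A e.rng e.src : ℤ)

/-- `aᵏ · (e μ) = (aᵏ · e) (aᵏ|_e · μ)`. -/
def actList {N : ℕ} {A : Matrix (Fin N) (Fin N) ℕ} (B : Matrix (Fin N) (Fin N) ℤ) :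
    ℤ → List (Edge A) → List (Edge A)
  | _, [] => []
  | k, e :: μ => actEdge B k e :: actList B (resEdge B k e) μ

/-- The exponent of `aᵏ|_μ`, where `aᵏ|_{e μ} = (aᵏ|_e)|_μ`. -/
def resList {N : ℕ} {A : Matrix (Fin N) (Fin N) ℕ} (B : Matrix (Fin N) (Fin N) ℤ) :
    ℤ → List (Edge A) → ℤ
  | k, [] => k
  | k, e :: μ => resList B (resEdge B k e) μ

section
variable {N : ℕ} {A : Matrix (Fin N) (Fin N) ℕ} (B : Matrix (Fin N) (Fin N) ℤ)

theorem actEdge_lbl (k : ℤ) (e : Edge A) : (((actEdge B k e).lbl.val : ℕ) : ℤ) =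
    (k * B e.rng e.src + (e.lbl.val : ℤ)) % (A e.rng e.src : ℤ) := by
  have h : (0 : ℤ) < (A e.rng e.src : ℤ) := by
    have := e.lbl.isLt
    omega
  exact Int.toNat_of_nonneg (Int.emod_nonneg _ h.ne')

theorem edge_eq {e f : Edge A} (h1 : e.rng = f.rng) (h2 : e.src = f.src)
    (h3 : (e.lbl.val : ℤ) = f.lbl.val) : e = f := by
  cases e; cases f
  simp only at h1 h2
  subst h1; subst h2
  congr 1
  exact Fin.ext (by exact_mod_cast h3)

theorem actEdge_zero (e : Edge A) : actEdge B 0 e = e := by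
  refine edge_eq rfl rfl ?_
  rw [actEdge_lbl, zero_mul, zero_add]
  exact Int.emod_eq_of_lt (by positivity) (by exact_mod_cast e.lbl.isLt)

theorem resEdge_zero (e : Edge A) : resEdge B 0 e = 0 := by
  unfold resEdge
  rw [zero_mul, zero_add]
  exact Int.ediv_eq_zero_of_lt (by positivity) (by exact_mod_cast e.lbl.isLt)

theorem actEdge_add (k l : ℤ) (e : Edge A) :
    actEdge B (k + l) e = actEdge B k (actEdge B l e) := by
  refine edge_eq rfl rfl ?_
  rw [actEdge_lbl, actEdge_lbl, actEdge_lbl]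
  change _ = (k * B e.rng e.src + _) % (A e.rng e.src : ℤ)
  rw [Int.add_emod_emod]
  ring_nf

theorem resEdge_add (k l : ℤ) (e : Edge A) :
    resEdge B (k + l) e = resEdge B k (actEdge B l e) + resEdge B l e := by
  have h : (A e.rng e.src : ℤ) ≠ 0 := by
    have := e.lbl.isLt
    omega
  have h0 : resEdge B k (actEdge B l e) =
      (k * B e.rng e.src + ((actEdge B l e).lbl.val : ℤ)) / (A e.rng e.src : ℤ) := rfl
  rw [h0, actEdge_lbl]
  unfold resEdge
  rw [← Int.add_mul_ediv_right _ _ h]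
  congr 1
  have := Int.emod_add_mul_ediv (l * B e.rng e.src + (e.lbl.val : ℤ)) (A e.rng e.src : ℤ)
  linarith

theorem actList_zero (μ : List (Edge A)) : actList B 0 μ = μ := by
  induction μ with
  | nil => rfl
  | cons e μ ih => rw [actList, actEdge_zero, resEdge_zero, ih]

theorem actList_add (k l : ℤ) (μ : List (Edge A)) :
    actList B (k + l) μ = actList B k (actList B l μ) := by
  induction μ generalizing k l with
  | nil => rfl
  | cons e μ ih => rw [actList, actList, actList, actEdge_add, resEdge_add, ih]

theorem actList_append (k : ℤ) (μ ν : List (Edge A)) :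
    actList B k (μ ++ ν) = actList B k μ ++ actList B (resList B k μ) ν := by
  induction μ generalizing k with
  | nil => rfl
  | cons e μ ih => simp only [List.cons_append, actList, resList, ih]

theorem isPath_actList (k : ℤ) (i : Fin N) (μ : List (Edge A)) (h : IsPath i μ) :
    IsPath i (actList B k μ) := by
  induction μ generalizing k i with
  | nil => trivial
  | cons e μ ih => exact ⟨h.1, ih _ _ h.2⟩

theorem isPath_append (i : Fin N) (μ ν : List (Edge A)) (h : IsPath i μ)
    (h' : IsPath (pathSrc i μ) ν) : IsPath i (μ ++ ν) := by
  induction μ generalizing i with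
  | nil => exact h'
  | cons e μ ih => exact ⟨h.1, ih _ h.2 h'⟩

theorem length_actList (k : ℤ) (μ : List (Edge A)) : (actList B k μ).length = μ.length := by
  induction μ generalizing k with
  | nil => rfl
  | cons e μ ih => simp only [actList, List.length_cons, ih]

/-- The homomorphism `φ_{A,B}` at the vertex `i`: the generator `a_i` of `ℤ × {i}` acts on
`i E_A^*` by a (length- and prefix-preserving) bijection. -/
def hom (i : Fin N) : Multiplicative ℤ →* Equiv.Perm (PathFrom A i) where
  toFun k :=
    { toFun := fun μ => ⟨actList B k.toAdd μ.1, isPath_actList B _ _ _ μ.2⟩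
      invFun := fun μ => ⟨actList B (-k.toAdd) μ.1, isPath_actList B _ _ _ μ.2⟩
      left_inv := fun μ => Subtype.ext (by
        change actList B _ (actList B _ μ.1) = μ.1
        rw [← actList_add, neg_add_cancel, actList_zero])
      right_inv := fun μ => Subtype.ext (by
        change actList B _ (actList B _ μ.1) = μ.1
        rw [← actList_add, add_neg_cancel, actList_zero]) }
  map_one' := Equiv.ext fun μ => Subtype.ext (actList_zero B μ.1)
  map_mul' k l := Equiv.ext fun μ => Subtype.ext (actList_add B k.toAdd l.toAdd μ.1)

end

/-- The isotropy group `(G_B)_i` of the faithful KEP-action: the quotient of `ℤ × {i}` by the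
kernel of its action on `i E_A^*`. The groupoid `G_B` is the group bundle `Σ i, (G_B)_i`. -/
abbrev GB {N : ℕ} (A : Matrix (Fin N) (Fin N) ℕ) (B : Matrix (Fin N) (Fin N) ℤ) (i : Fin N) :
    Type :=
  Multiplicative ℤ ⧸ (hom (A := A) B i).ker

/-- The faithful action of `(G_B)_i` on `i E_A^*`. -/
noncomputable def GB.act {N : ℕ} {A : Matrix (Fin N) (Fin N) ℕ} {B : Matrix (Fin N) (Fin N) ℤ}
    {i : Fin N} (g : GB A B i) (μ : PathFrom A i) : PathFrom A i :=
  QuotientGroup.kerLift (hom (A := A) B i) g μ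

theorem res_rel {N : ℕ} {A : Matrix (Fin N) (Fin N) ℕ} {B : Matrix (Fin N) (Fin N) ℤ}
    {i : Fin N} (μ : PathFrom A i) (k l : Multiplicative ℤ)
    (h : QuotientGroup.leftRel (hom (A := A) B i).ker k l) :
    QuotientGroup.leftRel (hom (A := A) B (pathSrc i μ.1)).ker
      (Multiplicative.ofAdd (resList B k.toAdd μ.1))
      (Multiplicative.ofAdd (resList B l.toAdd μ.1)) := by
  have key : ∀ (j : Fin N) (a b : Multiplicative ℤ),
      QuotientGroup.leftRel (hom (A := A) B j).ker a b ↔ hom (A := A) B j a = hom B j b := by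
    intro j a b
    rw [QuotientGroup.leftRel_apply, MonoidHom.mem_ker, map_mul, map_inv, inv_mul_eq_one]
  rw [key] at h ⊢
  refine Equiv.ext fun ν => Subtype.ext ?_
  have e := congrArg Subtype.val
    (Equiv.congr_fun h ⟨μ.1 ++ ν.1, isPath_append i μ.1 ν.1 μ.2 ν.2⟩)
  change actList B k.toAdd (μ.1 ++ ν.1) = actList B l.toAdd (μ.1 ++ ν.1) at e
  rw [actList_append, actList_append] at e
  exact (List.append_inj e (by rw [length_actList, length_actList])).2

/-- The restriction `g|_μ ∈ (G_B)_{s(μ)}` of `g ∈ (G_B)_i` to `μ ∈ i E_A^*`: if `g` is the class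
of `aᵏ`, it is the class of `aᵏ|_μ`. -/
def GB.res {N : ℕ} {A : Matrix (Fin N) (Fin N) ℕ} {B : Matrix (Fin N) (Fin N) ℤ}
    {i : Fin N} (g : GB A B i) (μ : PathFrom A i) : GB A B (pathSrc i μ.1) :=
  Quotient.map' (fun k : Multiplicative ℤ => Multiplicative.ofAdd (resList B k.toAdd μ.1))
    (res_rel μ) g

/-- The faithful KEP-action `(G_B, E_A)` is regular: for every `g ∈ G_B` there is `K` such that
`g · μ = μ` and `|μ| ≥ K` imply `g|_μ = s(μ)`. -/
def IsRegular {N : ℕ} (A : Matrix (Fin N) (Fin N) ℕ) (B : Matrix (Fin N) (Fin N) ℤ) : Prop :=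
  ∀ (i : Fin N) (g : GB A B i), ∃ K : ℕ, ∀ μ : PathFrom A i,
    K ≤ μ.1.length → g.act μ = μ → g.res μ = 1

/-! ### Left-infinite paths and the limit space -/

/-- The space `E_A^{-∞}` of left-infinite paths `… e₋₃ e₋₂ e₋₁` with `s(e_{k-1}) = r(e_k)`, where
`e_{-(n+1)}` is stored as `x n`; it has the product topology. -/
abbrev LeftPath {N : ℕ} (A : Matrix (Fin N) (Fin N) ℕ) : Type :=
  {x : ℕ → Edge A // ∀ n, (x (n + 1)).src = (x n).rng}

/-- The shift `σ` on `E_A^{-∞}`, deleting the last edge `e₋₁`. -/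
def LeftPath.shift {N : ℕ} {A : Matrix (Fin N) (Fin N) ℕ} (x : LeftPath A) : LeftPath A :=
  ⟨fun n => x.1 (n + 1), fun n => x.2 (n + 1)⟩

/-- The list of the edges `e_{-(n+1)} … e₋₁`. -/
def LeftPath.segList {N : ℕ} {A : Matrix (Fin N) (Fin N) ℕ} (x : LeftPath A) :
    ℕ → List (Edge A)
  | 0 => [x.1 0]
  | n + 1 => x.1 (n + 1) :: x.segList n

theorem LeftPath.isPath_segList {N : ℕ} {A : Matrix (Fin N) (Fin N) ℕ} (x : LeftPath A) (n : ℕ) :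
    IsPath (x.1 n).rng (x.segList n) := by
  induction n with
  | zero => exact ⟨rfl, trivial⟩
  | succ n ih =>
    refine ⟨rfl, ?_⟩
    rw [x.2 n]
    exact ih

/-- The finite path `e_{-(n+1)} … e₋₁`. -/
def LeftPath.seg {N : ℕ} {A : Matrix (Fin N) (Fin N) ℕ} (x : LeftPath A) (n : ℕ) :
    PathFrom A (x.1 n).rng :=
  ⟨x.segList n, x.isPath_segList n⟩

/-- Asymptotic equivalence: there are a finite set `F ⊆ G_B` and `g_k ∈ F` (`k < 0`) with
`d(g_k) = r(x_k)` and `g_k · x_k … x₋₁ = y_k … y₋₁`. -/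
def AsympEquiv {N : ℕ} (A : Matrix (Fin N) (Fin N) ℕ) (B : Matrix (Fin N) (Fin N) ℤ)
    (x y : LeftPath A) : Prop :=
  ∃ F : Set (Σ i : Fin N, GB A B i), F.Finite ∧
    ∃ g : ∀ n : ℕ, GB A B (x.1 n).rng,
      (∀ n, (⟨(x.1 n).rng, g n⟩ : Σ i : Fin N, GB A B i) ∈ F) ∧
      ∀ n, ((g n).act (x.seg n)).1 = y.segList n

section
variable {N : ℕ} {A : Matrix (Fin N) (Fin N) ℕ} {B : Matrix (Fin N) (Fin N) ℤ}

theorem GB.act_mk {i : Fin N} (k : Multiplicative ℤ) (μ : PathFrom A i) :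
    (GB.act (QuotientGroup.mk k : GB A B i) μ).1 = actList B k.toAdd μ.1 := rfl

theorem LeftPath.segList_inj {x y : LeftPath A} (h : ∀ n, x.segList n = y.segList n) : x = y := by
  refine Subtype.ext (funext fun n => ?_)
  cases n with
  | zero => exact (List.cons.inj (h 0)).1
  | succ n => exact (List.cons.inj (h (n + 1))).1

theorem AsympEquiv.vertex {x y : LeftPath A} (h : AsympEquiv A B x y) (n : ℕ) :
    (x.1 n).rng = (y.1 n).rng ∧ (x.1 n).src = (y.1 n).src := by
  obtain ⟨F, -, g, -, hg⟩ := h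
  have h := hg n
  obtain ⟨k, hk⟩ := QuotientGroup.mk_surjective (g n)
  rw [← hk, GB.act_mk] at h
  cases n with
  | zero =>
    have := (List.cons.inj h).1
    rw [← this]
    exact ⟨rfl, rfl⟩
  | succ n =>
    have := (List.cons.inj h).1
    rw [← this]
    exact ⟨rfl, rfl⟩

theorem AsympEquiv.rfl' (x : LeftPath A) : AsympEquiv A B x x := by
  refine ⟨Set.range fun i => ⟨i, 1⟩, Set.finite_range _, fun n => 1, fun n => ⟨_, rfl⟩, ?_⟩
  intro n
  exact actList_zero B _

theorem AsympEquiv.symm' {x y : LeftPath A} (h : AsympEquiv A B x y) : AsympEquiv A B y x := by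
  have hv := fun n => (h.vertex n).1
  obtain ⟨F, hF, g, hgF, hg⟩ := h
  choose k hk using fun n => QuotientGroup.mk_surjective (g n)
  refine ⟨(fun p => ⟨p.1, p.2⁻¹⟩) '' F, hF.image _,
    fun n => QuotientGroup.mk (k n)⁻¹, fun n => ⟨_, hgF n, ?_⟩, fun n => ?_⟩
  · rw [← hk n]
    have : ∀ (i j : Fin N) (hij : i = j) (a : Multiplicative ℤ),
        (⟨i, (QuotientGroup.mk a : GB A B i)⁻¹⟩ : Σ i : Fin N, GB A B i) =
          ⟨j, QuotientGroup.mk a⁻¹⟩ := by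
      intro i j hij a
      subst hij
      rfl
    exact this _ _ (hv n) _
  · have h := hg n
    rw [← hk n, GB.act_mk] at h
    rw [GB.act_mk]
    change actList B (-(k n).toAdd) (y.segList n) = _
    rw [← h, ← actList_add, neg_add_cancel, actList_zero]
    rfl

theorem AsympEquiv.trans' {x y z : LeftPath A} (h : AsympEquiv A B x y)
    (h' : AsympEquiv A B y z) : AsympEquiv A B x z := by
  have hv := fun n => (h.vertex n).1
  obtain ⟨F, hF, g, hgF, hg⟩ := h
  obtain ⟨F', hF', g', hgF', hg'⟩ := h'
  choose k hk using fun n => QuotientGroup.mk_surjective (g n)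
  choose k' hk' using fun n => QuotientGroup.mk_surjective (g' n)
  let mul : (Σ i : Fin N, GB A B i) → (Σ i : Fin N, GB A B i) → (Σ i : Fin N, GB A B i) :=
    fun p q => if hpq : q.1 = p.1 then ⟨p.1, p.2 * hpq ▸ q.2⟩ else p
  refine ⟨Set.image2 mul F' F, hF'.image2 _ hF,
    fun n => QuotientGroup.mk (k' n * k n), fun n => ⟨_, hgF' n, _, hgF n, ?_⟩, fun n => ?_⟩
  · rw [← hk n, ← hk' n]
    have : ∀ (i j : Fin N) (hij : i = j) (a b : Multiplicative ℤ),
        mul ⟨j, QuotientGroup.mk a⟩ ⟨i, QuotientGroup.mk b⟩ =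
          ⟨i, QuotientGroup.mk (a * b)⟩ := by
      intro i j hij a b
      subst hij
      simp only [mul, dif_pos]
      rfl
    exact this _ _ (hv n) _ _
  · have h := hg n
    have h' := hg' n
    rw [← hk n, GB.act_mk] at h
    rw [← hk' n, GB.act_mk] at h'
    rw [GB.act_mk]
    change actList B ((k' n).toAdd + (k n).toAdd) (x.segList n) = _
    rw [actList_add, ← h']
    exact congrArg _ h

theorem LeftPath.segList_succ (x : LeftPath A) (n : ℕ) :
    x.segList (n + 1) = x.shift.segList n ++ [x.1 0] := by
  induction n with
  | zero => rfl
  | succ n ih =>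
    change x.1 (n + 2) :: x.segList (n + 1) = x.1 (n + 2) :: (x.shift.segList n ++ [x.1 0])
    rw [ih]

theorem AsympEquiv.shift {x y : LeftPath A} (h : AsympEquiv A B x y) :
    AsympEquiv A B x.shift y.shift := by
  obtain ⟨F, hF, g, hgF, hg⟩ := h
  refine ⟨F, hF, fun n => g (n + 1), fun n => hgF (n + 1), fun n => ?_⟩
  have h := hg (n + 1)
  obtain ⟨k, hk⟩ := QuotientGroup.mk_surjective (g (n + 1))
  rw [← hk, GB.act_mk] at h
  change actList B k.toAdd (x.segList (n + 1)) = _ at h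
  rw [x.segList_succ, y.segList_succ, actList_append] at h
  change (GB.act (g (n + 1)) (x.shift.seg n)).1 = _
  rw [← hk]
  exact (List.append_inj' h rfl).1

end

/-- Asymptotic equivalence as an equivalence relation on `E_A^{-∞}`. -/
def asympSetoid {N : ℕ} (A : Matrix (Fin N) (Fin N) ℕ) (B : Matrix (Fin N) (Fin N) ℤ) :
    Setoid (LeftPath A) where
  r := AsympEquiv A B
  iseqv := ⟨AsympEquiv.rfl', AsympEquiv.symm', AsympEquiv.trans'⟩

/-- The limit space `J = E_A^{-∞} / ∼_ae`, with the quotient topology. -/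
def LimitSpace {N : ℕ} (A : Matrix (Fin N) (Fin N) ℕ) (B : Matrix (Fin N) (Fin N) ℤ) : Type :=
  Quotient (asympSetoid A B)

instance {N : ℕ} (A : Matrix (Fin N) (Fin N) ℕ) (B : Matrix (Fin N) (Fin N) ℤ) :
    TopologicalSpace (LimitSpace A B) :=
  inferInstanceAs (TopologicalSpace (Quotient (asympSetoid A B)))

/-- The quotient map `q : E_A^{-∞} → J`. -/
def toLimit {N : ℕ} {A : Matrix (Fin N) (Fin N) ℕ} (B : Matrix (Fin N) (Fin N) ℤ)
    (x : LeftPath A) : LimitSpace A B :=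
  Quotient.mk (asympSetoid A B) x

/-- The shift `σ̃` on the limit space, induced by `σ`. -/
def LimitSpace.shift {N : ℕ} {A : Matrix (Fin N) (Fin N) ℕ} {B : Matrix (Fin N) (Fin N) ℤ} :
    LimitSpace A B → LimitSpace A B :=
  Quotient.map LeftPath.shift (fun _ _ h => AsympEquiv.shift h)

/-! ### The connectivity graph and the factor maps -/

/-- The connectivity matrix `C` of `E_A`: `C i j = 1` if there is an edge in `E_A` with range `i`
and source `j`, and `C i j = 0` otherwise. -/
def connMatrix {N : ℕ} (A : Matrix (Fin N) (Fin N) ℕ) : Matrix (Fin N) (Fin N) ℕ :=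
  fun i j => if A i j = 0 then 0 else 1

/-- The space `E_C^{-∞}`. As the graph `E_C` has no multiple edges, a left-infinite path in it is
given by its vertices `… v₋₃ v₋₂ v₋₁` (the sources of its edges), with `C_{v_{k-1},v_k} = 1` for
all `k < 0`; `v_{-(n+1)}` is stored as `v n`. -/
abbrev VertexPath {N : ℕ} (A : Matrix (Fin N) (Fin N) ℕ) : Type :=
  {v : ℕ → Fin N // ∀ n, connMatrix A (v (n + 1)) (v n) = 1}

/-- The shift `σ` on `E_C^{-∞}`. -/
def VertexPath.shift {N : ℕ} {A : Matrix (Fin N) (Fin N) ℕ} (v : VertexPath A) : VertexPath A :=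
  ⟨fun n => v.1 (n + 1), fun n => v.2 (n + 1)⟩

/-- The factor map `π : E_A^{-∞} → E_C^{-∞}`. -/
def proj {N : ℕ} {A : Matrix (Fin N) (Fin N) ℕ} (x : LeftPath A) : VertexPath A :=
  ⟨fun n => (x.1 n).src, fun n => by
    have h : A (x.1 n).rng (x.1 n).src ≠ 0 := by
      have := (x.1 n).lbl.isLt
      omega
    change connMatrix A (x.1 (n + 1)).src (x.1 n).src = 1
    rw [x.2 n, connMatrix, if_neg h]⟩

/-- The induced factor map `π_J : J → E_C^{-∞}`. -/
def projJ {N : ℕ} {A : Matrix (Fin N) (Fin N) ℕ} {B : Matrix (Fin N) (Fin N) ℤ} :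
    LimitSpace A B → VertexPath A :=
  Quotient.lift proj (fun _ _ h => Subtype.ext (funext fun n => (AsympEquiv.vertex h n).2))

/-- The fibre `π⁻¹(v)`. -/
abbrev Fib {N : ℕ} {A : Matrix (Fin N) (Fin N) ℕ} (v : VertexPath A) : Type :=
  {x : LeftPath A // proj x = v}

/-- The fibre `π_J⁻¹(v)`. -/
abbrev FibJ {N : ℕ} {A : Matrix (Fin N) (Fin N) ℕ} (B : Matrix (Fin N) (Fin N) ℤ)
    (v : VertexPath A) : Type :=
  {z : LimitSpace A B // projJ z = v}

/-- The restriction `σ : π⁻¹(v) → π⁻¹(σ(v))`. -/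
def Fib.shift {N : ℕ} {A : Matrix (Fin N) (Fin N) ℕ} {v : VertexPath A} (x : Fib v) :
    Fib v.shift :=
  ⟨x.1.shift, congrArg VertexPath.shift x.2⟩

theorem projJ_shift {N : ℕ} {A : Matrix (Fin N) (Fin N) ℕ} {B : Matrix (Fin N) (Fin N) ℤ}
    (z : LimitSpace A B) : projJ z.shift = (projJ z).shift := by
  induction z using Quotient.inductionOn
  rfl

/-- The restriction `σ̃ : π_J⁻¹(v) → π_J⁻¹(σ(v))`. -/
def FibJ.shift {N : ℕ} {A : Matrix (Fin N) (Fin N) ℕ} {B : Matrix (Fin N) (Fin N) ℤ}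
    {v : VertexPath A} (z : FibJ B v) : FibJ B v.shift :=
  ⟨z.1.shift, (projJ_shift z.1).trans (congrArg VertexPath.shift z.2)⟩

/-- The class in `π_J⁻¹(v)` of a path in `π⁻¹(v)`. -/
def Fib.toJ {N : ℕ} {A : Matrix (Fin N) (Fin N) ℕ} (B : Matrix (Fin N) (Fin N) ℤ)
    {v : VertexPath A} (x : Fib v) : FibJ B v :=
  ⟨toLimit B x.1, x.2⟩

/-- `π⁻¹(v_{-K-1} … v₋₁)`: the finite paths `e_{-K} … e₋₁` in `E_A` with `r(e_k) = v_{k-1}` and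
`s(e_k) = v_k`, where `e_{-(t+1)}` is stored as `p t`; a finite set with the discrete topology. -/
abbrev FinPath {N : ℕ} {A : Matrix (Fin N) (Fin N) ℕ} (v : VertexPath A) (K : ℕ) : Type :=
  {p : Fin K → Edge A // ∀ t : Fin K, (p t).rng = v.1 (t + 1) ∧ (p t).src = v.1 t}

/-- The shift `π⁻¹(v_{-K-2} … v₋₁) → π⁻¹(v_{-K-2} … v₋₂)`, deleting the last edge `e₋₁`. -/
def FinPath.shift {N : ℕ} {A : Matrix (Fin N) (Fin N) ℕ} {v : VertexPath A} {K : ℕ}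
    (p : FinPath v (K + 1)) : FinPath v.shift K :=
  ⟨fun t => p.1 t.succ, fun t => p.2 t.succ⟩

/-- The path `e_{-K} … e₋₁` formed by the last `K` edges of a path in `π⁻¹(v)`. -/
def Fib.last {N : ℕ} {A : Matrix (Fin N) (Fin N) ℕ} {v : VertexPath A} (x : Fib v) (K : ℕ) :
    FinPath v K :=
  ⟨fun t => x.1.1 t, fun t => by
    obtain ⟨x, rfl⟩ := x
    exact ⟨(x.2 t).symm, rfl⟩⟩

/-- `K(v) = -min {k < 0 | B_{v_{k-1},v_k} = 0} ∈ ℕ ∪ {∞}`, equal to `0` if the set is empty and to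
`∞` if it has no least element. -/
noncomputable def lastZero {N : ℕ} {A : Matrix (Fin N) (Fin N) ℕ} (B : Matrix (Fin N) (Fin N) ℤ)
    (v : VertexPath A) : ℕ∞ :=
  ⨆ n ∈ {n : ℕ | B (v.1 (n + 1)) (v.1 n) = 0}, ((n + 1 : ℕ) : ℕ∞)

/-- `A_{v[k,-1]} = ∏_{k ≤ j ≤ -1} A_{v_{j-1},v_j}` for `k = -(n+1)`. -/
def prodA {N : ℕ} {A : Matrix (Fin N) (Fin N) ℕ} (v : VertexPath A) (n : ℕ) : ℕ :=
  ∏ j ∈ Finset.range (n + 1), A (v.1 (j + 1)) (v.1 j)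

/-- `max_{k < 0} A_{v[k,-1]} ∈ ℕ ∪ {∞}`. -/
noncomputable def maxA {N : ℕ} {A : Matrix (Fin N) (Fin N) ℕ} (v : VertexPath A) : ℕ∞ :=
  ⨆ n : ℕ, (prodA v n : ℕ∞)

/-- The real number `∑_{k < 0} i_k / A_{v[k,-1]}` for a path in `π⁻¹(v)` with labels `i_k`. -/
noncomputable def angle {N : ℕ} {A : Matrix (Fin N) (Fin N) ℕ} {v : VertexPath A} (x : Fib v) : ℝ :=
  ∑' n : ℕ, ((x.1.1 n).lbl.val : ℝ) / (prodA v n : ℝ)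

end KEP

namespace KEP

section
variable {N : ℕ} {A : Matrix (Fin N) (Fin N) ℕ} {B : Matrix (Fin N) (Fin N) ℤ}

/-! ### Edges with vanishing `B` -/

/-! Everything reduces to how an integer exponent travels along a path from left to right.

At an edge with `B = 0` every exponent acts trivially and restricts to `0`, so equivalent paths
agree at that edge and everywhere to its right (`AsympEquiv.eq_of_zero`). With infinitely many zeros
equivalence is therefore equality. If the leftmost zero is at `e_{-K}`, equivalence means
equivalence of the parts left of it and equality of the last `K` edges
(`asympEquiv_iff_shift_iterate`).

Without zeros `B = 1` along `v`, and the action is an odometer: `aᵏ` adds `k` to a mixed radix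
integer, the leftmost label being the least significant digit, modulo the number of paths
(`actList_init_eq_iff`). Divided by that number, these integers are the partial sums of the angle.
If the products of `A` are unbounded, equivalence therefore means that the angles differ by an
integer (`asympEquiv_iff_angle`), and every angle in `[0, 1)` occurs. If they are bounded,
regularity forces them all to be `1` (`IsRegular.count_eq_one`), which leaves a single path.

Topologically, fibres of `π` are compact and those of `π_J` are their quotients, so a continuous
surjection onto a Hausdorff space with the right identifications yields each homeomorphism. Since
`E_C^{-∞}` is totally disconnected, components lie in fibres, and each fibre is a point or a circle
times a totally disconnected space. -/

theorem actEdge_of_eq_zero {e : Edge A} (h : B e.rng e.src = 0) (k : ℤ) : actEdge B k e = e := by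
  refine edge_eq rfl rfl ?_
  rw [actEdge_lbl, h, mul_zero, zero_add]
  exact Int.emod_eq_of_lt (by positivity) (by exact_mod_cast e.lbl.isLt)

theorem resEdge_of_eq_zero {e : Edge A} (h : B e.rng e.src = 0) (k : ℤ) : resEdge B k e = 0 := by
  unfold resEdge
  rw [h, mul_zero, zero_add]
  exact Int.ediv_eq_zero_of_lt (by positivity) (by exact_mod_cast e.lbl.isLt)

theorem actList_cons_of_eq_zero {e : Edge A} (h : B e.rng e.src = 0) (k : ℤ) (μ : List (Edge A)) :
    actList B k (e :: μ) = e :: μ := by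
  rw [actList, actEdge_of_eq_zero h, resEdge_of_eq_zero h, actList_zero]

/-! ### Asymptotic equivalence in terms of integer exponents -/

/-- Finitely many classes have representatives with bounded exponents. Conversely, bounded exponents
over finitely many vertices give finitely many classes. -/
theorem asympEquiv_iff {x y : LeftPath A} : AsympEquiv A B x y ↔
    ∃ M : ℕ, ∀ n, ∃ k : ℤ, |k| ≤ M ∧ actList B k (x.segList n) = y.segList n := by
  constructor
  · rintro ⟨F, hF, g, hgF, hg⟩
    let lift : (Σ i : Fin N, GB A B i) → ℤ := fun p => (Quotient.out p.2).toAdd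
    obtain ⟨M, hM⟩ := (hF.image fun p => (lift p).natAbs).bddAbove
    refine ⟨M, fun n => ⟨lift ⟨_, g n⟩, ?_, ?_⟩⟩
    · rw [Int.abs_eq_natAbs]
      exact_mod_cast hM ⟨_, hgF n, rfl⟩
    · rw [← hg n]
      conv_rhs => rw [← Quotient.out_eq (g n)]
      rfl
  · rintro ⟨M, h⟩
    choose k hk hk' using h
    refine ⟨(fun p : Fin N × ℤ => ⟨p.1, QuotientGroup.mk (Multiplicative.ofAdd p.2)⟩) ''
      (Set.univ ×ˢ Set.Icc (-(M : ℤ)) M), (Set.finite_univ.prod (Set.finite_Icc _ _)).image _,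
      fun n => QuotientGroup.mk (Multiplicative.ofAdd (k n)), fun n => ⟨(_, k n), ?_, rfl⟩, hk'⟩
    exact ⟨trivial, abs_le.1 (hk n)⟩

/-! ### Segments and iterated shifts -/

/-- The list of the edges `e_{-n} … e₋₁`. -/
def LeftPath.init (x : LeftPath A) : ℕ → List (Edge A)
  | 0 => []
  | n + 1 => x.1 n :: x.init n

theorem LeftPath.segList_eq_init (x : LeftPath A) (n : ℕ) : x.segList n = x.init (n + 1) := by
  induction n with
  | zero => rfl
  | succ n ih => rw [segList, ih]; rfl

theorem LeftPath.init_congr {x y : LeftPath A} {n : ℕ} :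
    x.init n = y.init n ↔ ∀ j < n, x.1 j = y.1 j := by
  induction n with
  | zero => simp [init]
  | succ n ih =>
    simp only [init, List.cons.injEq, ih, Nat.lt_succ_iff_lt_or_eq]
    grind

theorem LeftPath.length_init (x : LeftPath A) (n : ℕ) : (x.init n).length = n := by
  induction n with
  | zero => rfl
  | succ n ih => simp [init, ih]

theorem LeftPath.shift_iterate_apply (x : LeftPath A) (K n : ℕ) :
    (shift^[K] x).1 n = x.1 (n + K) := by
  induction K generalizing x with
  | zero => rfl
  | succ K ih => rw [Function.iterate_succ_apply, ih]; rfl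

theorem VertexPath.shift_iterate_apply (v : VertexPath A) (K n : ℕ) :
    (shift^[K] v).1 n = v.1 (n + K) := by
  induction K generalizing v with
  | zero => rfl
  | succ K ih => rw [Function.iterate_succ_apply, ih]; rfl

theorem proj_shift_iterate (x : LeftPath A) (K : ℕ) :
    proj (LeftPath.shift^[K] x) = VertexPath.shift^[K] (proj x) :=
  Function.Semiconj.iterate_right (f := proj) (fun _ => rfl) K x

theorem LeftPath.init_add (x : LeftPath A) (n K : ℕ) :
    x.init (n + K) = (shift^[K] x).init n ++ x.init K := by
  induction n with
  | zero => simp [init]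
  | succ n ih =>
    rw [Nat.add_right_comm, init, init, shift_iterate_apply, ih, List.cons_append]

theorem LeftPath.isPath_init (x : LeftPath A) (n : ℕ) : IsPath (x.1 n).src (x.init n) := by
  induction n with
  | zero => trivial
  | succ n ih => exact ⟨(x.2 n).symm, ih⟩

theorem LeftPath.pathSrc_init (x : LeftPath A) (n : ℕ) :
    pathSrc (x.1 n).src (x.init n) = (x.1 0).src := by
  induction n with
  | zero => rfl
  | succ n ih => exact ih

theorem Fib.src_eq {v : VertexPath A} (x : Fib v) (n : ℕ) : (x.1.1 n).src = v.1 n :=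
  congrFun (congrArg Subtype.val x.2) n

theorem Fib.rng_eq {v : VertexPath A} (x : Fib v) (n : ℕ) : (x.1.1 n).rng = v.1 (n + 1) := by
  rw [← x.1.2 n, x.src_eq]

theorem VertexPath.pos (v : VertexPath A) (n : ℕ) : 0 < A (v.1 (n + 1)) (v.1 n) := by
  have := v.2 n
  unfold connMatrix at this
  split_ifs at this
  omega

/-- The left-infinite path with vertices `v` and labels `i`. -/
def VertexPath.withLabels (v : VertexPath A) (i : ∀ n, Fin (A (v.1 (n + 1)) (v.1 n))) :
    Fib v :=
  ⟨⟨fun n => ⟨v.1 (n + 1), v.1 n, i n⟩, fun _ => rfl⟩, rfl⟩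

instance (v : VertexPath A) : Nonempty (Fib v) := ⟨v.withLabels fun n => ⟨0, v.pos n⟩⟩

/-- The label of the edge `e_{-(n+1)}`. -/
def Fib.digit {v : VertexPath A} (x : Fib v) (n : ℕ) : ℕ := (x.1.1 n).lbl.val

theorem Fib.digit_lt {v : VertexPath A} (x : Fib v) (n : ℕ) :
    x.digit n < A (v.1 (n + 1)) (v.1 n) := by
  have h : x.digit n < A (x.1.1 n).rng (x.1.1 n).src := (x.1.1 n).lbl.isLt
  rwa [x.rng_eq, x.src_eq] at h

theorem Fib.ext_digit {v : VertexPath A} {x y : Fib v} (h : ∀ n, x.digit n = y.digit n) : x = y :=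
  Subtype.ext <| Subtype.ext <| funext fun n =>
    edge_eq (by rw [x.rng_eq, y.rng_eq]) (by rw [x.src_eq, y.src_eq]) (congrArg Nat.cast (h n))

/-! ### The function `K(v)` -/

theorem lastZero_le_iff {v : VertexPath A} {K : ℕ} :
    lastZero B v ≤ K ↔ ∀ n, B (v.1 (n + 1)) (v.1 n) = 0 → n + 1 ≤ K := by
  simp only [lastZero, iSup₂_le_iff, Set.mem_ofPred_eq, Nat.cast_le]

theorem lt_lastZero_iff {v : VertexPath A} {K : ℕ} :
    K < lastZero B v ↔ ∃ n, B (v.1 (n + 1)) (v.1 n) = 0 ∧ K ≤ n := by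
  rw [← not_le, lastZero_le_iff]
  push Not
  simp only [Nat.lt_succ_iff]

theorem lastZero_eq_zero_iff {v : VertexPath A} :
    lastZero B v = 0 ↔ ∀ n, B (v.1 (n + 1)) (v.1 n) ≠ 0 := by
  rw [← nonpos_iff_eq_zero, ← Nat.cast_zero, lastZero_le_iff]
  simp only [Nat.le_zero, Nat.succ_ne_zero, imp_false, ne_eq]

theorem lastZero_eq_top_iff {v : VertexPath A} :
    lastZero B v = ⊤ ↔ ∀ K, ∃ n, B (v.1 (n + 1)) (v.1 n) = 0 ∧ K ≤ n := by
  simp only [← lt_lastZero_iff, ENat.eq_top_iff_forall_gt]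

theorem lastZero_eq_succ_iff {v : VertexPath A} {K : ℕ} :
    lastZero B v = (K + 1 : ℕ) ↔ B (v.1 (K + 1)) (v.1 K) = 0 ∧
      ∀ n, B (v.1 (n + 1)) (v.1 n) = 0 → n ≤ K := by
  rw [le_antisymm_iff, lastZero_le_iff, Nat.cast_succ, ENat.add_one_le_iff (by simp),
    lt_lastZero_iff]
  simp only [Nat.succ_le_succ_iff]
  constructor
  · rintro ⟨h, n, hn, hKn⟩
    obtain rfl := le_antisymm hKn (h n hn)
    exact ⟨hn, h⟩
  · rintro ⟨h, h'⟩
    exact ⟨h', K, h, le_rfl⟩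

theorem lastZero_shift_eq_top {v : VertexPath A} (h : lastZero B v = ⊤) :
    lastZero B v.shift = ⊤ := by
  rw [lastZero_eq_top_iff] at h ⊢
  intro K
  obtain ⟨n, hn, hK⟩ := h (K + 1)
  obtain ⟨n, rfl⟩ := Nat.exists_eq_add_of_le' (Nat.one_le_of_lt hK)
  exact ⟨n, hn, by omega⟩

theorem lastZero_shift_eq_zero {v : VertexPath A} (h : lastZero B v = 0) :
    lastZero B v.shift = 0 := by
  rw [lastZero_eq_zero_iff] at h ⊢
  exact fun n => h (n + 1)

theorem lastZero_shift {v : VertexPath A} {K : ℕ} (h : lastZero B v = (K + 1 : ℕ)) :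
    lastZero B v.shift = K := by
  rw [lastZero_eq_succ_iff] at h
  cases K with
  | zero =>
    rw [Nat.cast_zero, lastZero_eq_zero_iff]
    exact fun n hn => absurd (h.2 (n + 1) hn) (by omega)
  | succ K =>
    rw [lastZero_eq_succ_iff]
    exact ⟨h.1, fun n hn => Nat.succ_le_succ_iff.1 (h.2 (n + 1) hn)⟩

theorem lastZero_shift_iterate {v : VertexPath A} {K : ℕ} (h : lastZero B v = K) :
    lastZero B (VertexPath.shift^[K] v) = 0 := by
  induction K generalizing v with
  | zero => exact h
  | succ K ih => exact ih (lastZero_shift h)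

/-! ### Asymptotic equivalence and zeros of `B` -/

/-- The segment of length `n + 1` starts with an edge where `B` vanishes, hence is fixed by every
exponent. -/
theorem AsympEquiv.eq_of_zero {v : VertexPath A} {x y : Fib v} (h : AsympEquiv A B x.1 y.1) {n : ℕ}
    (hn : B (v.1 (n + 1)) (v.1 n) = 0) {j : ℕ} (hj : j ≤ n) : x.1.1 j = y.1.1 j := by
  obtain ⟨M, hM⟩ := asympEquiv_iff.1 h
  obtain ⟨k, -, hk⟩ := hM n
  rw [x.1.segList_eq_init, y.1.segList_eq_init, LeftPath.init, actList_cons_of_eq_zero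
    (by rw [x.rng_eq, x.src_eq, hn])] at hk
  exact (LeftPath.init_congr (n := n + 1)).1 hk j (Nat.lt_succ_of_le hj)

theorem asympEquiv_iff_eq_of_top {v : VertexPath A} (hv : lastZero B v = ⊤) {x y : Fib v} :
    AsympEquiv A B x.1 y.1 ↔ x = y := by
  refine ⟨fun h => Subtype.ext <| Subtype.ext <| funext fun j => ?_, fun h => h ▸ .rfl' _⟩
  obtain ⟨n, hn, hj⟩ := lastZero_eq_top_iff.1 hv j
  exact h.eq_of_zero hn hj

theorem AsympEquiv.shift_iterate {x y : LeftPath A} (h : AsympEquiv A B x y) (K : ℕ) :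
    AsympEquiv A B (LeftPath.shift^[K] x) (LeftPath.shift^[K] y) := by
  induction K generalizing x y with
  | zero => exact h
  | succ K ih => exact ih h.shift

/-- The zero at `e_{-K}` absorbs every exponent arriving from the left. An exponent that works for
the shifted paths thus works for the longer segments of the original ones, while segments within the
last `K` edges already agree. -/
theorem asympEquiv_iff_shift_iterate {v : VertexPath A} {K : ℕ} (hv : lastZero B v = K)
    {x y : Fib v} : AsympEquiv A B x.1 y.1 ↔
      AsympEquiv A B (LeftPath.shift^[K] x.1) (LeftPath.shift^[K] y.1) ∧
        ∀ j < K, x.1.1 j = y.1.1 j := by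
  cases K with
  | zero => simp
  | succ K =>
  have hK := (lastZero_eq_succ_iff.1 hv).1
  refine ⟨fun h => ⟨h.shift_iterate _, fun j hj => h.eq_of_zero hK (Nat.le_of_lt_succ hj)⟩, ?_⟩
  rintro ⟨h, h'⟩
  obtain ⟨M, hM⟩ := asympEquiv_iff.1 h
  refine asympEquiv_iff.2 ⟨M, fun n => ?_⟩
  rcases le_or_gt n K with hn | hn
  · refine ⟨0, by simp, ?_⟩
    rw [actList_zero, LeftPath.segList_eq_init, LeftPath.segList_eq_init, LeftPath.init_congr]
    exact fun j hj => h' j (by omega)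
  · obtain ⟨m, rfl⟩ := Nat.exists_eq_add_of_le' (show K + 1 ≤ n from hn)
    obtain ⟨k, hk, hk'⟩ := hM m
    refine ⟨k, hk, ?_⟩
    rw [LeftPath.segList_eq_init, LeftPath.segList_eq_init] at hk' ⊢
    rw [Nat.add_right_comm, LeftPath.init_add _ (m + 1), LeftPath.init_add _ (m + 1),
      actList_append, hk']
    congr 1
    rw [← LeftPath.init_congr.2 h']
    -- The remaining factor starts with the zero edge, so the restricted exponent does not matter.
    exact actList_cons_of_eq_zero (by rw [x.rng_eq, x.src_eq, hK]) _ _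

/-! ### Segments along which `B = 1` act like an odometer -/

/-- The number whose digits, least significant first, are the labels of `e_{-n} … e₋₁`. -/
def LeftPath.value (x : LeftPath A) : ℕ → ℕ
  | 0 => 0
  | n + 1 => (x.1 n).lbl + A (x.1 n).rng (x.1 n).src * x.value n

/-- The number of paths `e_{-n} … e₋₁` over `v`. -/
def VertexPath.count (v : VertexPath A) (n : ℕ) : ℕ :=
  ∏ j ∈ Finset.range n, A (v.1 (j + 1)) (v.1 j)

theorem VertexPath.count_succ (v : VertexPath A) (n : ℕ) :
    v.count (n + 1) = v.count n * A (v.1 (n + 1)) (v.1 n) := Finset.prod_range_succ _ _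

theorem VertexPath.count_pos (v : VertexPath A) (n : ℕ) : 0 < v.count n :=
  Finset.prod_pos fun j _ => v.pos j

theorem VertexPath.count_mono (v : VertexPath A) : Monotone v.count :=
  monotone_nat_of_le_succ fun n => by
    rw [count_succ]
    exact Nat.le_mul_of_pos_right _ (v.pos n)

theorem prodA_eq_count (v : VertexPath A) (n : ℕ) : prodA v n = v.count (n + 1) := rfl

theorem prodA_shift (v : VertexPath A) (n : ℕ) :
    prodA v (n + 1) = A (v.1 1) (v.1 0) * prodA v.shift n := by
  rw [prodA, Finset.prod_range_succ', mul_comm]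
  rfl

theorem VertexPath.count_add (v : VertexPath A) (n m : ℕ) :
    v.count (n + m) = v.count n * (VertexPath.shift^[n] v).count m := by
  rw [count, Finset.prod_range_add]
  refine congrArg _ (Finset.prod_congr rfl fun j _ => ?_)
  rw [shift_iterate_apply, shift_iterate_apply]
  rw [Nat.add_comm n j, Nat.add_right_comm]

variable {v : VertexPath A}

theorem Fib.value_succ (x : Fib v) (n : ℕ) : x.1.value (n + 1) =
    x.digit n + A (v.1 (n + 1)) (v.1 n) * x.1.value n := by
  rw [← x.rng_eq, ← x.src_eq]
  rfl

theorem Fib.value_lt (x : Fib v) (n : ℕ) : x.1.value n < v.count n := by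
  induction n with
  | zero => exact Nat.one_pos
  | succ n ih =>
    rw [x.value_succ, v.count_succ]
    have := x.digit_lt n
    nlinarith

theorem Fib.resEdge_eq (hv : ∀ n, B (v.1 (n + 1)) (v.1 n) = 1) (x : Fib v) (n : ℕ) (k : ℤ) :
    resEdge B k (x.1.1 n) = (k + x.digit n) / (A (v.1 (n + 1)) (v.1 n) : ℤ) := by
  rw [resEdge, show B (x.1.1 n).rng (x.1.1 n).src = 1 by rw [x.rng_eq, x.src_eq, hv], mul_one,
    ← x.rng_eq, ← x.src_eq]
  rfl

/-- With `B = 1`, the rule `k + m = k̂ A + m̂` is one step of addition with carry: `m̂` is the new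
digit and `k̂` is the carry passed to the right. -/
theorem actList_init_eq_iff (hv : ∀ n, B (v.1 (n + 1)) (v.1 n) = 1) (x y : Fib v) (n : ℕ) (k : ℤ) :
    actList B k (x.1.init n) = y.1.init n ↔
      (v.count n : ℤ) ∣ x.1.value n + k - y.1.value n := by
  induction n generalizing k with
  | zero => simp [LeftPath.init, actList, VertexPath.count]
  | succ n ih =>
    have hB : B (x.1.1 n).rng (x.1.1 n).src = 1 := by rw [x.rng_eq, x.src_eq, hv]
    have hA : A (x.1.1 n).rng (x.1.1 n).src = A (v.1 (n + 1)) (v.1 n) := by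
      rw [x.rng_eq, x.src_eq]
    have hpos := v.pos n
    have hlt := y.digit_lt n
    have hact : (((actEdge B k (x.1.1 n)).lbl.val : ℕ) : ℤ) =
        (k + x.digit n) % (A (v.1 (n + 1)) (v.1 n) : ℤ) := by
      rw [actEdge_lbl, hB, mul_one, ← hA]
      rfl
    have h1 : actEdge B k (x.1.1 n) = y.1.1 n ↔
        (k + x.digit n) % (A (v.1 (n + 1)) (v.1 n) : ℤ) = y.digit n := by
      rw [← hact]
      refine ⟨fun h => by rw [h]; rfl, fun h => edge_eq ?_ ?_ h⟩
      · change (x.1.1 n).rng = _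
        rw [x.rng_eq, y.rng_eq]
      · change (x.1.1 n).src = _
        rw [x.src_eq, y.src_eq]
    rw [LeftPath.init, LeftPath.init, actList, List.cons.injEq, ih, h1, x.value_succ,
      y.value_succ, v.count_succ, x.resEdge_eq hv]
    clear hact h1 hA
    generalize A (v.1 (n + 1)) (v.1 n) = a at *
    push_cast
    have hd := Int.emod_add_mul_ediv (k + x.digit n : ℤ) (a : ℤ)
    set q := (k + x.digit n : ℤ) / (a : ℤ)
    have ha : (a : ℤ) ≠ 0 := by omega
    constructor
    · rintro ⟨h, h'⟩
      rw [h] at hd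
      have h2 : (x.digit n + a * x.1.value n + k - (y.digit n + a * y.1.value n) : ℤ) =
          (x.1.value n + q - y.1.value n) * a := by linear_combination -hd
      rw [h2]
      exact mul_dvd_mul_right h' (a : ℤ)
    · intro h
      have h' : (k + x.digit n : ℤ) % a = y.digit n := by
        -- Reduction modulo `a` isolates the lowest digit; dividing by `a` afterwards leaves the
        -- statement for `n` with the carry `q` as exponent.
        have h3 : (a : ℤ) ∣ (k + x.digit n : ℤ) - y.digit n := by
          rw [← dvd_add_left (Dvd.intro (x.1.value n - y.1.value n : ℤ) rfl)]
          convert (Dvd.intro_left _ rfl : (a : ℤ) ∣ v.count n * a).trans h using 1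
          ring
        rw [Int.emod_eq_emod_iff_emod_sub_eq_zero.2 (Int.emod_eq_zero_of_dvd h3)]
        exact Int.emod_eq_of_lt (by positivity) (by exact_mod_cast hlt)
      refine ⟨h', ?_⟩
      rw [h'] at hd
      have h2 : (x.digit n + a * x.1.value n + k - (y.digit n + a * y.1.value n) : ℤ) =
          (x.1.value n + q - y.1.value n) * a := by linear_combination -hd
      rw [h2] at h
      exact (mul_dvd_mul_iff_right ha).1 h

theorem asympEquiv_iff_value (hv : ∀ n, B (v.1 (n + 1)) (v.1 n) = 1) {x y : Fib v} :
    AsympEquiv A B x.1 y.1 ↔ ∃ M : ℕ, ∀ n, ∃ k : ℤ, |k| ≤ M ∧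
      (v.count (n + 1) : ℤ) ∣ x.1.value (n + 1) + k - y.1.value (n + 1) := by
  simp only [asympEquiv_iff, LeftPath.segList_eq_init, actList_init_eq_iff hv]

/-- Every `A` on the segment is `1`, so all labels are `0` and the exponent passes through
unchanged. -/
theorem resList_init_of_count_eq_one (hv : ∀ n, B (v.1 (n + 1)) (v.1 n) = 1) (x : Fib v) {n : ℕ}
    (h : v.count n = 1) (k : ℤ) : resList B k (x.1.init n) = k := by
  induction n generalizing k with
  | zero => rfl
  | succ n ih =>
    rw [v.count_succ, mul_eq_one] at h
    have hl := x.digit_lt n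
    rw [LeftPath.init, resList, ih h.1, x.resEdge_eq hv, h.2, Nat.cast_one, Int.ediv_one]
    omega

/-! ### Regularity -/

/-- A class is a unit of the quotient exactly when its exponent acts trivially on all paths; this
removes the quotient from regularity. -/
theorem IsRegular.exists_actList_resList (hreg : IsRegular A B) (i : Fin N) (k : ℤ) :
    ∃ K : ℕ, ∀ μ ν : List (Edge A), IsPath i μ → IsPath (pathSrc i μ) ν → K ≤ μ.length →
      actList B k μ = μ → actList B (resList B k μ) ν = ν := by
  obtain ⟨K, hK⟩ := hreg i (QuotientGroup.mk (Multiplicative.ofAdd k))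
  refine ⟨K, fun μ ν hμ hν hl h => ?_⟩
  have := hK ⟨μ, hμ⟩ hl (Subtype.ext h)
  have h2 : (QuotientGroup.mk (Multiplicative.ofAdd (resList B k μ)) : GB A B (pathSrc i μ)) = 1 :=
    this
  rw [QuotientGroup.eq_one_iff, MonoidHom.mem_ker] at h2
  exact congrArg Subtype.val (Equiv.congr_fun h2 ⟨ν, hν⟩)

/-- Far to the left all `A` are `1`. Some vertex `i` recurs there, giving a long closed path at `i`
that `a_i` fixes and along which it restricts to itself. By regularity `a_i` acts trivially, yet on
the remaining `m` edges it adds `1` modulo `v.count m`. -/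
theorem IsRegular.count_eq_one (hreg : IsRegular A B) (hv : ∀ n, B (v.1 (n + 1)) (v.1 n) = 1)
    {M : ℕ} (hM : ∀ n, v.count n ≤ M) (n : ℕ) : v.count n = 1 := by
  obtain ⟨n₀, hn₀⟩ : ∃ n₀, ∀ n, n₀ ≤ n → v.count n = v.count n₀ := by
    obtain ⟨n₀, hn₀⟩ := Set.exists_max_image (Set.range v.count) id
      ((Set.finite_Iic M).subset (Set.range_subset_iff.2 hM)) ⟨_, 0, rfl⟩
    obtain ⟨⟨n₀, rfl⟩, h⟩ := hn₀
    exact ⟨n₀, fun n hn => le_antisymm (h _ ⟨n, rfl⟩) (v.count_mono hn)⟩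
  obtain ⟨i, hi⟩ := Finite.exists_infinite_fiber v.1
  rw [Set.infinite_coe_iff] at hi
  -- Beyond `n₀` the count is constant; beyond `n`, triviality of `v.count m` yields that of
  -- `v.count n`.
  obtain ⟨m, hmi, hm⟩ := hi.exists_gt (n + n₀)
  obtain ⟨K, hK⟩ := hreg.exists_actList_resList i 1
  obtain ⟨m', hm'i, hm'⟩ := hi.exists_gt (m + K)
  obtain ⟨l, rfl⟩ := Nat.exists_eq_add_of_le (show m ≤ m' by omega)
  obtain ⟨x⟩ := (inferInstance : Nonempty (Fib v))
  let w := VertexPath.shift^[m] v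
  let y : Fib w := ⟨LeftPath.shift^[m] x.1, by rw [proj_shift_iterate, x.2]⟩
  have hw : ∀ n, B (w.1 (n + 1)) (w.1 n) = 1 := fun n => by
    simp only [w, VertexPath.shift_iterate_apply, Nat.add_right_comm, hv]
  have hwl : w.count l = 1 := by
    have h := v.count_add m l
    rw [hn₀ (m + l) (by omega), hn₀ m (by omega)] at h
    exact (Nat.eq_of_mul_eq_mul_left (v.count_pos n₀) (by rw [mul_one]; exact h)).symm
  have hyl : (y.1.1 l).src = i := by
    rw [y.src_eq, VertexPath.shift_iterate_apply, Nat.add_comm]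
    exact hm'i
  have hy0 : (y.1.1 0).src = i := by
    rw [y.src_eq, VertexPath.shift_iterate_apply, Nat.zero_add]
    exact hmi
  have h1 := hK (y.1.init l) (x.1.init m) (hyl ▸ y.1.isPath_init l)
    (by
      rw [← hyl, LeftPath.pathSrc_init, hy0, ← show v.1 m = i from hmi, ← x.src_eq]
      exact x.1.isPath_init m)
    (by rw [LeftPath.length_init]; omega)
    (by rw [actList_init_eq_iff hw, hwl, Nat.cast_one]; exact one_dvd _)
  rw [resList_init_of_count_eq_one hw _ hwl, actList_init_eq_iff hv] at h1
  have h2 : v.count m = 1 := by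
    have h3 : (v.count m : ℤ) ∣ 1 := by simpa using h1
    exact Nat.dvd_one.1 (by exact_mod_cast h3)
  exact le_antisymm (h2 ▸ v.count_mono (by omega)) (v.count_pos n)

end

end KEP

namespace KEP

section
variable {N : ℕ} {A : Matrix (Fin N) (Fin N) ℕ} {B : Matrix (Fin N) (Fin N) ℤ} {v : VertexPath A}

/-! ### Unbounded products -/

theorem maxA_eq_top_iff : maxA v = ⊤ ↔ ∀ M : ℕ, ∃ n, M < prodA v n := by
  simp only [maxA, ENat.iSup_natCast_eq_top, not_bddAbove_iff, Set.exists_range_iff]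

theorem maxA_shift_eq_top (h : maxA v = ⊤) : maxA v.shift = ⊤ := by
  rw [maxA_eq_top_iff] at h ⊢
  intro M
  obtain ⟨n, hn⟩ := h (A (v.1 1) (v.1 0) * (M + 1))
  cases n with
  | zero =>
    have h0 : prodA v 0 = A (v.1 1) (v.1 0) := by simp [prodA]
    rw [h0] at hn
    nlinarith [v.pos 0]
  | succ n =>
    rw [prodA_shift] at hn
    exact ⟨n, by have := Nat.lt_of_mul_lt_mul_left hn; omega⟩

/-- This turns estimates with bounded error into exact equalities of angles. -/
theorem eq_zero_of_count_mul_le (h : maxA v = ⊤) {d C : ℝ} (hd : ∀ n, v.count n * |d| ≤ C) :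
    d = 0 := by
  by_contra hne
  have hpos := abs_pos.2 hne
  obtain ⟨M, hM⟩ := exists_nat_gt (C / |d|)
  obtain ⟨n, hn⟩ := maxA_eq_top_iff.1 h M
  have h1 := hd (n + 1)
  rw [← le_div_iff₀ hpos, ← prodA_eq_count] at h1
  have h2 : (M : ℝ) < prodA v n := by exact_mod_cast hn
  linarith

/-! ### The angle -/

theorem VertexPath.count_pos_real (v : VertexPath A) (n : ℕ) : (0 : ℝ) < v.count n := by
  exact_mod_cast v.count_pos n

theorem Fib.sum_range_digit (x : Fib v) (n : ℕ) :
    ∑ j ∈ Finset.range n, (x.digit j : ℝ) / prodA v j = x.1.value n / v.count n := by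
  induction n with
  | zero => simp [LeftPath.value]
  | succ n ih =>
    have h1 := (v.count_pos_real n).ne'
    have h2 : (A (v.1 (n + 1)) (v.1 n) : ℝ) ≠ 0 := by exact_mod_cast (v.pos n).ne'
    rw [Finset.sum_range_succ, ih, prodA_eq_count, x.value_succ, v.count_succ]
    push_cast
    field_simp
    ring

theorem Fib.summable_digit (x : Fib v) : Summable fun n => (x.digit n : ℝ) / prodA v n := by
  refine summable_of_sum_range_le (c := 1) (fun n => by positivity) fun n => ?_
  rw [x.sum_range_digit, div_le_one (v.count_pos_real n)]
  exact_mod_cast (x.value_lt n).le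

theorem Fib.value_le_mul_angle (x : Fib v) (n : ℕ) : x.1.value n ≤ v.count n * angle x := by
  rw [← div_le_iff₀' (v.count_pos_real n), ← x.sum_range_digit]
  exact x.summable_digit.sum_le_tsum _ fun n _ => by positivity

/-- A digit is at most `A - 1`, so the intervals from `value / count` to `(value + 1) / count` are
nested. The angle lies in all of them. -/
theorem Fib.antitone_value_add_one_div (x : Fib v) :
    Antitone fun n => ((x.1.value n : ℝ) + 1) / v.count n := by
  refine antitone_nat_of_succ_le fun n => ?_
  have h1 := v.count_pos_real n
  have h2 : (0 : ℝ) < A (v.1 (n + 1)) (v.1 n) := by exact_mod_cast v.pos n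
  have h3 : (x.digit n : ℝ) + 1 ≤ A (v.1 (n + 1)) (v.1 n) := by exact_mod_cast x.digit_lt n
  rw [x.value_succ, v.count_succ, Nat.cast_mul, ← div_div, div_le_iff₀ h2, div_mul_eq_mul_div]
  push_cast
  gcongr
  linarith

theorem Fib.mul_angle_le (x : Fib v) (n : ℕ) : v.count n * angle x ≤ x.1.value n + 1 := by
  rw [← le_div_iff₀' (v.count_pos_real n)]
  refine le_of_tendsto x.summable_digit.hasSum.tendsto_sum_nat ?_
  filter_upwards [Filter.eventually_ge_atTop n] with m hm
  rw [x.sum_range_digit]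
  refine le_trans ?_ (x.antitone_value_add_one_div hm)
  exact div_le_div_of_nonneg_right (by linarith) (v.count_pos_real m).le

/-- The edge `e₋₁` carries the leading digit. Multiplying by its radix turns that digit into an
integer part, which the circle does not see. -/
theorem Fib.angle_shift (x : Fib v) :
    angle x.shift = A (v.1 1) (v.1 0) * angle x - x.digit 0 := by
  have h0 : (A (v.1 1) (v.1 0) : ℝ) ≠ 0 := by exact_mod_cast (v.pos 0).ne'
  have h1 : prodA v 0 = A (v.1 1) (v.1 0) := by simp [prodA]
  have h2 : angle x = x.digit 0 / prodA v 0 + ∑' n, (x.digit (n + 1) : ℝ) / prodA v (n + 1) :=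
    x.summable_digit.tsum_eq_zero_add
  rw [h2, h1, mul_add, mul_div_cancel₀ _ h0, add_sub_cancel_left, ← tsum_mul_left]
  refine tsum_congr fun n => ?_
  rw [prodA_shift, Nat.cast_mul, ← mul_div_assoc, mul_div_mul_left _ _ h0]
  rfl

theorem asympEquiv_iff_angle (hv : ∀ n, B (v.1 (n + 1)) (v.1 n) = 1) (hA : maxA v = ⊤)
    {x y : Fib v} : AsympEquiv A B x.1 y.1 ↔ ∃ m : ℤ, angle x = angle y + m := by
  rw [asympEquiv_iff_value hv]
  constructor
  · rintro ⟨M, hM⟩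
    -- The integer supplied by the divisibility depends on `n`. The nearest integer to the
    -- difference is fixed and approximates it at least as well.
    refine ⟨round (angle x - angle y), ?_⟩
    rw [← sub_eq_iff_eq_add', ← sub_eq_zero]
    refine eq_zero_of_count_mul_le (C := M + 1) hA fun n => ?_
    cases n with
    | zero =>
      have := abs_sub_round (angle x - angle y)
      simp only [VertexPath.count, Finset.range_zero, Finset.prod_empty, Nat.cast_one, one_mul]
      have : (0 : ℝ) ≤ M := by positivity
      linarith
    | succ n =>
      obtain ⟨k, hk, m, hm⟩ := hM n
      have h0 := v.count_pos_real (n + 1)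
      have h1 := x.value_le_mul_angle (n + 1)
      have h2 := x.mul_angle_le (n + 1)
      have h3 := y.value_le_mul_angle (n + 1)
      have h4 := y.mul_angle_le (n + 1)
      have h5 : (x.1.value (n + 1) + k - y.1.value (n + 1) : ℝ) = v.count (n + 1) * m := by
        exact_mod_cast hm
      have hk' : |(k : ℝ)| ≤ M := by exact_mod_cast hk
      rw [abs_le] at hk'
      refine (mul_le_mul_of_nonneg_left (round_le _ m) h0.le).trans ?_
      rw [← abs_of_pos h0, ← abs_mul, abs_le]
      constructor <;> linarith
  · rintro ⟨m, hm⟩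
    -- Each value is within `1` below `count * angle`, so this exponent is a difference of two
    -- numbers in `[0, 1]`.
    refine ⟨1, fun n => ⟨m * v.count (n + 1) - x.1.value (n + 1) + y.1.value (n + 1), ?_,
      m, by ring⟩⟩
    have h1 := x.value_le_mul_angle (n + 1)
    have h2 := x.mul_angle_le (n + 1)
    have h3 := y.value_le_mul_angle (n + 1)
    have h4 := y.mul_angle_le (n + 1)
    rw [hm] at h1 h2
    have : |(m * v.count (n + 1) - x.1.value (n + 1) + y.1.value (n + 1) : ℝ)| ≤ 1 := by
      rw [abs_le]
      constructor <;> linarith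
    exact_mod_cast this

theorem exists_angle_eq (hA : maxA v = ⊤) {θ : ℝ} (h0 : 0 ≤ θ) (h1 : θ < 1) :
    ∃ x : Fib v, angle x = θ := by
  -- These are the digits of the mixed radix expansion of `θ`, chosen so that each value is `⌊count
  -- * θ⌋`; `θ < 1` gives the empty value `0`.
  let x : Fib v := v.withLabels fun n =>
    ⟨⌊v.count (n + 1) * θ⌋₊ % A (v.1 (n + 1)) (v.1 n), Nat.mod_lt _ (v.pos n)⟩
  have hx : ∀ n, x.1.value n = ⌊v.count n * θ⌋₊ := by
    intro n
    induction n with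
    | zero => simpa [LeftPath.value, VertexPath.count, eq_comm] using h1
    | succ n ih =>
      have h2 : (A (v.1 (n + 1)) (v.1 n) : ℝ) ≠ 0 := by exact_mod_cast (v.pos n).ne'
      have h3 : (v.count n * θ : ℝ) = v.count (n + 1) * θ / A (v.1 (n + 1)) (v.1 n) := by
        rw [v.count_succ]
        push_cast
        field_simp
      rw [x.value_succ, ih, h3, Nat.floor_div_natCast]
      exact Nat.mod_add_div _ _
  refine ⟨x, sub_eq_zero.1 <| eq_zero_of_count_mul_le (C := 1) hA fun n => ?_⟩
  have h2 := v.count_pos_real n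
  have h3 := x.value_le_mul_angle n
  have h4 := x.mul_angle_le n
  rw [hx] at h3 h4
  have h5 := Nat.floor_le (mul_nonneg h2.le h0)
  have h6 := Nat.lt_floor_add_one (v.count n * θ)
  rw [← abs_of_pos h2, ← abs_mul, abs_le]
  constructor <;> linarith

/-! ### Continuity of the angle and the map to the circle -/

instance : DiscreteTopology (Edge A) := ⟨rfl⟩

theorem Fib.continuous_edge (n : ℕ) : Continuous fun x : Fib v => x.1.1 n :=
  (continuous_apply n).comp (continuous_subtype_val.comp continuous_subtype_val)

theorem continuous_angle : Continuous (angle : Fib v → ℝ) := by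
  -- The path with maximal labels gives a summable series dominating all others.
  let y : Fib v := v.withLabels fun n => ⟨A (v.1 (n + 1)) (v.1 n) - 1, Nat.sub_one_lt (v.pos n).ne'⟩
  refine continuous_tsum (u := fun n => (y.digit n : ℝ) / prodA v n) (fun n => ?_)
    y.summable_digit fun n x => ?_
  · exact (continuous_of_discreteTopology (f := fun e : Edge A => (e.lbl.val : ℝ) / prodA v n)).comp
      (Fib.continuous_edge n)
  · rw [Real.norm_of_nonneg (by positivity)]
    have : x.digit n ≤ y.digit n := Nat.le_sub_one_of_lt (x.digit_lt n)
    gcongr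
    exact this

/-- The point of the circle determined by a path in `π⁻¹(v)`. -/
noncomputable def toCircle (x : Fib v) : Circle := Circle.exp (2 * Real.pi * angle x)

theorem continuous_toCircle : Continuous (toCircle : Fib v → Circle) :=
  Circle.exp.continuous.comp (continuous_const.mul continuous_angle)

theorem toCircle_eq_iff (hv : ∀ n, B (v.1 (n + 1)) (v.1 n) = 1) (hA : maxA v = ⊤)
    {x y : Fib v} : toCircle x = toCircle y ↔ AsympEquiv A B x.1 y.1 := by
  rw [asympEquiv_iff_angle hv hA, toCircle, toCircle, Circle.exp_eq_exp]
  refine exists_congr fun m => ?_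
  have := Real.two_pi_pos.ne'
  constructor
  · intro h
    apply mul_left_cancel₀ this
    linarith
  · intro h
    rw [h]
    ring

theorem toCircle_surjective (hA : maxA v = ⊤) : Function.Surjective (toCircle : Fib v → Circle) := by
  intro z
  obtain ⟨x, hx⟩ := exists_angle_eq hA (Int.fract_nonneg (Complex.arg z / (2 * Real.pi)))
    (Int.fract_lt_one _)
  refine ⟨x, ?_⟩
  rw [toCircle, hx, Int.fract, mul_sub, mul_div_cancel₀ _ Real.two_pi_pos.ne', Circle.exp_sub,
    Circle.exp_two_pi_mul_int, div_one, Circle.exp_arg]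

theorem toCircle_shift (x : Fib v) : toCircle x.shift = toCircle x ^ A (v.1 1) (v.1 0) := by
  rw [toCircle, toCircle, x.angle_shift, mul_sub, Circle.exp_sub]
  have := Circle.exp_two_pi_mul_int (x.digit 0)
  rw [Int.cast_natCast] at this
  rw [this, div_one, ← Circle.exp_natCast_mul, mul_left_comm]

end

end KEP

/-! ### General topology of quotients and components -/

/-- Closed subsets of a closed subspace are closed in the whole space, so closedness can be tested
upstairs. -/
theorem Topology.IsQuotientMap.restrictPreimage_isClosed {X Y : Type*} [TopologicalSpace X]
    [TopologicalSpace Y] {f : X → Y} (hf : IsQuotientMap f) {s : Set Y} (hs : IsClosed s) :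
    IsQuotientMap (s.restrictPreimage f) := by
  refine isQuotientMap_iff_isClosed.2 ⟨hf.surjective.restrictPreimage _, fun t => ?_⟩
  rw [hs.isClosedEmbedding_subtypeVal.isClosed_iff_image_isClosed, ← hf.isClosed_preimage,
    (hs.preimage hf.continuous).isClosedEmbedding_subtypeVal.isClosed_iff_image_isClosed,
    Set.image_val_preimage_restrictPreimage]

/-- A quotient of `X` is homeomorphic to every Hausdorff image of the compact space `X` under a
continuous map that makes the same identifications. -/
theorem Topology.IsQuotientMap.exists_homeomorph {X Y Z : Type*} [TopologicalSpace X]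
    [TopologicalSpace Y] [TopologicalSpace Z] [CompactSpace X] [T2Space Z] {f : X → Y} {g : X → Z}
    (hf : IsQuotientMap f) (hg : Continuous g) (hs : Function.Surjective g)
    (h : ∀ x y, g x = g y ↔ f x = f y) : ∃ e : Y ≃ₜ Z, ∀ x, e (f x) = g x := by
  -- Compact to Hausdorff makes `g` closed. Two quotient maps with the same fibres have homeomorphic
  -- targets, without `Y` being known to be Hausdorff.
  have hg' : IsQuotientMap g := hg.isClosedMap.isQuotientMap hg hs
  have h1 : ∀ x, g (Function.surjInv hf.surjective (f x)) = g x := fun x =>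
    (h _ _).2 (Function.surjInv_eq hf.surjective _)
  have h2 : ∀ x, f (Function.surjInv hs (g x)) = f x := fun x =>
    (h _ _).1 (Function.surjInv_eq hs _)
  refine ⟨⟨⟨fun y => g (Function.surjInv hf.surjective y), fun z => f (Function.surjInv hs z),
    fun y => ?_, fun z => ?_⟩, ?_, ?_⟩, h1⟩
  · obtain ⟨x, rfl⟩ := hf.surjective y
    simp only [h1, h2]
  · obtain ⟨x, rfl⟩ := hs z
    simp only [h1, h2]
  · exact hf.continuous_iff.2 (hg.congr fun x => (h1 x).symm)
  · exact hg'.continuous_iff.2 (hf.continuous.congr fun x => (h2 x).symm)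

/-- If the fibre of a map to a totally disconnected space is a product of a connected and a totally
disconnected space, its connected components are copies of the connected factor. -/
theorem nonempty_connectedComponent_homeomorph {X Y C D : Type*} [TopologicalSpace X]
    [TopologicalSpace Y] [TopologicalSpace C] [TopologicalSpace D] [TotallyDisconnectedSpace Y]
    [ConnectedSpace C] [TotallyDisconnectedSpace D] {p : X → Y} (hp : Continuous p) (z : X)
    (e : {x // p x = p z} ≃ₜ C × D) : Nonempty (connectedComponent z ≃ₜ C) := by
  have hcomp : ∀ x ∈ connectedComponent z, p x = p z := fun x hx =>
    (isPreconnected_connectedComponent.image p hp.continuousOn).subsingleton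
      (Set.mem_image_of_mem p hx) (Set.mem_image_of_mem p mem_connectedComponent)
  let ι : connectedComponent z → {x // p x = p z} := fun x => ⟨x, hcomp x x.2⟩
  have hι : Continuous ι := continuous_subtype_val.subtype_mk _
  have : PreconnectedSpace (connectedComponent z) :=
    Subtype.preconnectedSpace isPreconnected_connectedComponent
  have h2 : ∀ x, (e (ι x)).2 = (e ⟨z, rfl⟩).2 := fun x =>
    (isPreconnected_range (continuous_snd.comp (e.continuous.comp hι))).subsingleton
      (Set.mem_range_self x) (Set.mem_range_self (⟨z, mem_connectedComponent⟩ : connectedComponent z))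
  -- The slice through `z` is connected, so it lies in the component; the `D`-coordinate is constant
  -- there by `h2`, so the slice is all of it.
  let s : C → X := fun c => e.symm (c, (e ⟨z, rfl⟩).2)
  have hs : Continuous s := by fun_prop
  have hmem : ∀ c, s c ∈ connectedComponent z := fun c => by
    refine (isPreconnected_range hs).subset_connectedComponent ⟨(e ⟨z, rfl⟩).1, ?_⟩
      (Set.mem_range_self c)
    simp [s]
  refine ⟨⟨⟨fun x => (e (ι x)).1, fun c => ⟨s c, hmem c⟩, fun x => ?_, fun c => ?_⟩, by fun_prop,
    by fun_prop⟩⟩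
  · refine Subtype.ext ?_
    simp only [s, ← h2 x, Prod.mk.eta, Homeomorph.symm_apply_apply]
    rfl
  · have : ι ⟨s c, hmem c⟩ = e.symm (c, (e ⟨z, rfl⟩).2) := rfl
    simp [this]

namespace KEP

section
variable {N : ℕ} {A : Matrix (Fin N) (Fin N) ℕ} {B : Matrix (Fin N) (Fin N) ℤ} {v : VertexPath A}

/-! ### The factor maps -/

instance : Finite (Edge A) :=
  Finite.of_surjective
    (fun p : Σ ij : Fin N × Fin N, Fin (A ij.1 ij.2) => (⟨p.1.1, p.1.2, p.2⟩ : Edge A))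
    fun e => ⟨⟨(e.rng, e.src), e.lbl⟩, rfl⟩

instance : CompactSpace (LeftPath A) := by
  refine isCompact_iff_compactSpace.1 (IsClosed.isCompact (s := {x | _}) ?_)
  simp only [Set.ofPred_forall]
  refine isClosed_iInter fun n => isClosed_eq ?_ ?_
  · exact continuous_of_discreteTopology.comp (continuous_apply (n + 1))
  · exact continuous_of_discreteTopology.comp (continuous_apply n)

theorem continuous_proj : Continuous (proj : LeftPath A → VertexPath A) :=
  Continuous.subtype_mk (continuous_pi fun n => (continuous_of_discreteTopology
    (f := fun e : Edge A => e.src)).comp ((continuous_apply n).comp continuous_subtype_val)) _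

theorem proj_surjective : Function.Surjective (proj : LeftPath A → VertexPath A) := fun v =>
  ⟨(Classical.arbitrary (Fib v)).1, (Classical.arbitrary (Fib v)).2⟩

theorem isQuotientMap_toLimit : Topology.IsQuotientMap (toLimit B : LeftPath A → LimitSpace A B) :=
  isQuotientMap_quotient_mk'

theorem continuous_projJ : Continuous (projJ : LimitSpace A B → VertexPath A) :=
  isQuotientMap_toLimit.continuous_iff.2 continuous_proj

theorem projJ_surjective : Function.Surjective (projJ : LimitSpace A B → VertexPath A) := fun v =>
  let ⟨x, hx⟩ := proj_surjective v
  ⟨toLimit B x, hx⟩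

instance (v : VertexPath A) : CompactSpace (Fib v) :=
  isCompact_iff_compactSpace.1 (isClosed_singleton.preimage continuous_proj).isCompact

/-- As `π` is definitionally `π_J ∘ q`, `Fib v` is the full preimage under `q` of a closed fibre. -/
theorem isQuotientMap_toJ : Topology.IsQuotientMap (Fib.toJ B : Fib v → FibJ B v) :=
  isQuotientMap_toLimit.restrictPreimage_isClosed (s := projJ ⁻¹' {v})
    (isClosed_singleton.preimage continuous_projJ)

theorem toJ_eq_iff {x y : Fib v} : x.toJ B = y.toJ B ↔ AsympEquiv A B x.1 y.1 :=
  Subtype.ext_iff.trans Quotient.eq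

/-! ### The fibres of `π_J` -/

/-- No two paths are identified, so `Fib v` itself serves as the Hausdorff image, with the identity
map. -/
theorem exists_homeomorph_of_lastZero_eq_top (hv : lastZero B v = ⊤) :
    ∃ h : Fib v ≃ₜ FibJ B v, ∀ x, h x = x.toJ B := by
  obtain ⟨e, he⟩ := (isQuotientMap_toJ (B := B) (v := v)).exists_homeomorph continuous_id
    Function.surjective_id fun x y => by rw [toJ_eq_iff, asympEquiv_iff_eq_of_top hv]; rfl
  refine ⟨e.symm, fun x => ?_⟩
  rw [Homeomorph.symm_apply_eq, he, id]

theorem B_eq_one_of_lastZero_eq_zero (hB : ∀ i j, B i j = 0 ∨ B i j = 1) (hv : lastZero B v = 0)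
    (n : ℕ) : B (v.1 (n + 1)) (v.1 n) = 1 :=
  (hB _ _).resolve_left (lastZero_eq_zero_iff.1 hv n)

theorem exists_homeomorph_circle (hB : ∀ i j, B i j = 0 ∨ B i j = 1) (hv : lastZero B v = 0)
    (hA : maxA v = ⊤) : ∃ h : FibJ B v ≃ₜ Circle, ∀ x : Fib v, h (x.toJ B) = toCircle x :=
  isQuotientMap_toJ.exists_homeomorph continuous_toCircle (toCircle_surjective hA) fun x y => by
    rw [toJ_eq_iff, toCircle_eq_iff (B_eq_one_of_lastZero_eq_zero hB hv) hA]

theorem subsingleton_fib (hB : ∀ i j, B i j = 0 ∨ B i j = 1) (hreg : IsRegular A B)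
    (hv : lastZero B v = 0) (hA : maxA v < ⊤) : Subsingleton (Fib v) := by
  rw [lt_top_iff_ne_top, ne_eq, maxA_eq_top_iff] at hA
  push Not at hA
  obtain ⟨M, hM⟩ := hA
  have h := hreg.count_eq_one (B_eq_one_of_lastZero_eq_zero hB hv) (M := M)
    fun n => (v.count_mono n.le_succ).trans (hM n)
  refine ⟨fun x y => Fib.ext_digit fun n => ?_⟩
  have h1 := h (n + 1)
  rw [v.count_succ, h n, one_mul] at h1
  have hx := x.digit_lt n
  have hy := y.digit_lt n
  omega

theorem subsingleton_fibJ (hB : ∀ i j, B i j = 0 ∨ B i j = 1) (hreg : IsRegular A B)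
    (hv : lastZero B v = 0) (hA : maxA v < ⊤) : Subsingleton (FibJ B v) :=
  have := subsingleton_fib hB hreg hv hA
  isQuotientMap_toJ.surjective.subsingleton

/-- Needed for the first factor of the target in `exists_homeomorph_prod`. -/
theorem t2Space_fibJ (hB : ∀ i j, B i j = 0 ∨ B i j = 1) (hreg : IsRegular A B)
    (hv : lastZero B v = 0) : T2Space (FibJ B v) := by
  rcases eq_or_ne (maxA v) ⊤ with hA | hA
  · obtain ⟨h, -⟩ := exists_homeomorph_circle hB hv hA
    exact h.symm.t2Space
  · have := subsingleton_fibJ hB hreg hv hA.lt_top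
    infer_instance

/-- The map `σ^K : π⁻¹(v) → π⁻¹(σ^K(v))`. -/
def Fib.shiftIterate (x : Fib v) (K : ℕ) : Fib (VertexPath.shift^[K] v) :=
  ⟨LeftPath.shift^[K] x.1, by rw [proj_shift_iterate, x.2]⟩

theorem Fib.continuous_shiftIterate (K : ℕ) :
    Continuous fun x : Fib v => x.shiftIterate K := by
  refine Continuous.subtype_mk (Continuous.comp (Continuous.iterate ?_ K) continuous_subtype_val) _
  exact Continuous.subtype_mk (continuous_pi fun n =>
    (continuous_apply (A := fun _ : ℕ => Edge A) (n + 1)).comp continuous_subtype_val) _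

theorem Fib.continuous_last (K : ℕ) : Continuous fun x : Fib v => x.last K :=
  Continuous.subtype_mk (f := fun (x : Fib v) (t : Fin K) => x.1.1 t)
    (continuous_pi fun t => Fib.continuous_edge t) _

theorem Fib.last_eq_iff {x y : Fib v} {K : ℕ} :
    x.last K = y.last K ↔ ∀ j < K, x.1.1 j = y.1.1 j :=
  Subtype.ext_iff.trans <| funext_iff.trans ⟨fun h j hj => h ⟨j, hj⟩, fun h t => h t t.2⟩

/-- Both pieces lie over `v`, so they fit together at the junction. -/
theorem Fib.exists_shiftIterate_last (K : ℕ) (y : Fib (VertexPath.shift^[K] v))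
    (p : FinPath v K) : ∃ x : Fib v, x.shiftIterate K = y ∧ x.last K = p := by
  have hsrc : ∀ n, K ≤ n → (y.1.1 (n - K)).src = v.1 n := fun n hn => by
    rw [y.src_eq, VertexPath.shift_iterate_apply, Nat.sub_add_cancel hn]
  have hrng : ∀ n, K ≤ n → (y.1.1 (n - K)).rng = v.1 (n + 1) := fun n hn => by
    rw [y.rng_eq, VertexPath.shift_iterate_apply, Nat.add_right_comm, Nat.sub_add_cancel hn]
  let f : ℕ → Edge A := fun n => if h : n < K then p.1 ⟨n, h⟩ else y.1.1 (n - K)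
  have hf : ∀ n, (f n).rng = v.1 (n + 1) ∧ (f n).src = v.1 n := fun n => by
    by_cases h : n < K
    · simp only [f, dif_pos h]
      exact p.2 ⟨n, h⟩
    · simp only [f, dif_neg h]
      exact ⟨hrng n (not_lt.1 h), hsrc n (not_lt.1 h)⟩
  let x : Fib v := ⟨⟨f, fun n => (hf (n + 1)).2.trans (hf n).1.symm⟩,
    Subtype.ext (funext fun n => (hf n).2)⟩
  refine ⟨x, Subtype.ext <| Subtype.ext <| funext fun n => ?_, Subtype.ext <| funext fun t => ?_⟩
  · change (LeftPath.shift^[K] x.1).1 n = _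
    rw [LeftPath.shift_iterate_apply]
    simp [x, f]
  · change f t = p.1 t
    simp [f]

theorem exists_homeomorph_prod (hB : ∀ i j, B i j = 0 ∨ B i j = 1) (hreg : IsRegular A B) {K : ℕ}
    (hv : lastZero B v = K) :
    ∃ h : FibJ B v ≃ₜ FibJ B (VertexPath.shift^[K] v) × FinPath v K,
      ∀ x : Fib v, h (x.toJ B) = ((x.shiftIterate K).toJ B, x.last K) := by
  have := t2Space_fibJ hB hreg (lastZero_shift_iterate hv)
  refine isQuotientMap_toJ.exists_homeomorph
    ((isQuotientMap_toJ.continuous.comp (Fib.continuous_shiftIterate K)).prodMk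
      (Fib.continuous_last K)) ?_ fun x y => ?_
  · rintro ⟨z, p⟩
    obtain ⟨y, rfl⟩ := isQuotientMap_toJ.surjective z
    obtain ⟨x, rfl, rfl⟩ := Fib.exists_shiftIterate_last K y p
    exact ⟨x, rfl⟩
  · rw [Prod.mk.injEq, toJ_eq_iff, toJ_eq_iff, asympEquiv_iff_shift_iterate hv, Fib.last_eq_iff]
    rfl

/-! ### Connected components -/

theorem connectedComponent_eq_singleton_of_homeomorph {X C : Type*} [TopologicalSpace X]
    [TopologicalSpace C] [Subsingleton C] {z : X} (e : connectedComponent z ≃ₜ C) :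
    connectedComponent z = {z} :=
  (Set.subsingleton_coe _).1 e.injective.subsingleton |>.eq_singleton_of_mem mem_connectedComponent

theorem connectedComponent_eq_singleton_or_circle (hB : ∀ i j, B i j = 0 ∨ B i j = 1)
    (hreg : IsRegular A B) (z : LimitSpace A B) :
    connectedComponent z = {z} ∨ Nonempty (connectedComponent z ≃ₜ Circle) := by
  rcases eq_or_ne (lastZero B (projJ z)) ⊤ with hv | hv
  · obtain ⟨h, -⟩ := exists_homeomorph_of_lastZero_eq_top hv
    -- Here the connected factor is `Unit` and the path fibre is the totally disconnected one.
    obtain ⟨e⟩ := nonempty_connectedComponent_homeomorph continuous_projJ z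
      (h.symm.trans (Homeomorph.uniqueProd Unit _).symm)
    exact .inl (connectedComponent_eq_singleton_of_homeomorph e)
  · obtain ⟨K, hK⟩ := ENat.ne_top_iff_exists.1 hv
    obtain ⟨h, -⟩ := exists_homeomorph_prod hB hreg hK.symm
    have h0 := lastZero_shift_iterate hK.symm
    rcases eq_or_ne (maxA (VertexPath.shift^[K] (projJ z))) ⊤ with hA | hA
    · obtain ⟨e, -⟩ := exists_homeomorph_circle hB h0 hA
      exact .inr (nonempty_connectedComponent_homeomorph continuous_projJ z
        (h.trans (e.prodCongr (Homeomorph.refl _))))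
    · have := subsingleton_fibJ hB hreg h0 hA.lt_top
      have : Nonempty (FibJ B (VertexPath.shift^[K] (projJ z))) := ⟨(h ⟨z, rfl⟩).1⟩
      have : ConnectedSpace (FibJ B (VertexPath.shift^[K] (projJ z))) :=
        { toPreconnectedSpace := inferInstance, toNonempty := inferInstance }
      obtain ⟨e⟩ := nonempty_connectedComponent_homeomorph continuous_projJ z h
      exact .inl (connectedComponent_eq_singleton_of_homeomorph e)

end

end KEP

/-! ### The main theorem -/

theorem mainTheorem8 {N : ℕ} (A : Matrix (Fin N) (Fin N) ℕ) (B : Matrix (Fin N) (Fin N) ℤ)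
    (hAB : IsKatsuraPair A B) (hB : ∀ i j, B i j = 0 ∨ B i j = 1)
    (hreg : KEP.IsRegular A B) :
    -- every connected component is a point or a circle
    (∀ z : KEP.LimitSpace A B,
      connectedComponent z = {z} ∨ Nonempty (connectedComponent z ≃ₜ Circle)) ∧
    -- the two maps are factor maps
    (Continuous (KEP.proj : KEP.LeftPath A → KEP.VertexPath A) ∧
      Function.Surjective (KEP.proj : KEP.LeftPath A → KEP.VertexPath A) ∧
      Function.Semiconj (KEP.proj : KEP.LeftPath A → KEP.VertexPath A)
        KEP.LeftPath.shift KEP.VertexPath.shift) ∧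
    (Continuous (KEP.projJ : KEP.LimitSpace A B → KEP.VertexPath A) ∧
      Function.Surjective (KEP.projJ : KEP.LimitSpace A B → KEP.VertexPath A) ∧
      Function.Semiconj (KEP.projJ : KEP.LimitSpace A B → KEP.VertexPath A)
        KEP.LimitSpace.shift KEP.VertexPath.shift) ∧
    -- infinitely many zeros: the fibre is the fibre of the path space, the map is the shift
    (∃ h : ∀ v : KEP.VertexPath A, KEP.lastZero B v = ⊤ → (KEP.Fib v ≃ₜ KEP.FibJ B v),
      (∀ (v : KEP.VertexPath A) (hv : KEP.lastZero B v = ⊤) (x : KEP.Fib v),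
        h v hv x = x.toJ B) ∧
      ∀ (v : KEP.VertexPath A) (hv : KEP.lastZero B v = ⊤),
        ∃ hv' : KEP.lastZero B v.shift = ⊤,
        ∀ x : KEP.Fib v, (h v hv x).shift = h v.shift hv' x.shift) ∧
    -- no zeros, unbounded products: the fibre is a circle, the map is a power map
    (∃ h : ∀ v : KEP.VertexPath A, KEP.lastZero B v = 0 → KEP.maxA v = ⊤ →
        (KEP.FibJ B v ≃ₜ Circle),
      (∀ (v : KEP.VertexPath A) (hv : KEP.lastZero B v = 0) (hv₁ : KEP.maxA v = ⊤) (x : KEP.Fib v),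
        h v hv hv₁ (x.toJ B) = Circle.exp (2 * Real.pi * KEP.angle x)) ∧
      ∀ (v : KEP.VertexPath A) (hv : KEP.lastZero B v = 0) (hv₁ : KEP.maxA v = ⊤),
        ∃ (hv' : KEP.lastZero B v.shift = 0) (hv₁' : KEP.maxA v.shift = ⊤),
        ∀ z : KEP.FibJ B v, h v.shift hv' hv₁' z.shift = h v hv hv₁ z ^ A (v.1 1) (v.1 0)) ∧
    -- no zeros, bounded products: the fibres are single points
    (∀ v : KEP.VertexPath A, KEP.lastZero B v = 0 → KEP.maxA v < ⊤ →
      (∃! x : KEP.LeftPath A, KEP.proj x = v) ∧ ∃! z : KEP.LimitSpace A B, KEP.projJ z = v) ∧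
    -- finitely many zeros: a product with a finite path set, the map is the identity times the
    -- shift (for `K = 0` the identification is the trivial one with a one-point second factor)
    (∃ h : ∀ (K : ℕ) (v : KEP.VertexPath A), KEP.lastZero B v = K →
        (KEP.FibJ B v ≃ₜ KEP.FibJ B (KEP.VertexPath.shift^[K] v) × KEP.FinPath v K),
      (∀ (K : ℕ) (v : KEP.VertexPath A) (hv : KEP.lastZero B v = K),
        KEP.lastZero B (KEP.VertexPath.shift^[K] v) = 0 ∧
        ∀ x : KEP.Fib v, ((h K v hv (x.toJ B)).1 : KEP.LimitSpace A B) =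
            KEP.toLimit B (KEP.LeftPath.shift^[K] x.1) ∧
          (h K v hv (x.toJ B)).2 = x.last K) ∧
      ∀ (K : ℕ) (v : KEP.VertexPath A) (hv : KEP.lastZero B v = (K + 1 : ℕ)),
        ∃ hv' : KEP.lastZero B v.shift = K, ∀ z : KEP.FibJ B v,
          h K v.shift hv' z.shift = ((h (K + 1) v hv z).1, (h (K + 1) v hv z).2.shift)) := by
  refine ⟨KEP.connectedComponent_eq_singleton_or_circle hB hreg,
    ⟨KEP.continuous_proj, KEP.proj_surjective, fun _ => rfl⟩,
    ⟨KEP.continuous_projJ, KEP.projJ_surjective, KEP.projJ_shift⟩, ?_, ?_, ?_, ?_⟩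
  · choose h hh using fun (v : KEP.VertexPath A) (hv : KEP.lastZero B v = ⊤) =>
      KEP.exists_homeomorph_of_lastZero_eq_top hv
    refine ⟨h, hh, fun v hv => ⟨KEP.lastZero_shift_eq_top hv, fun x => ?_⟩⟩
    rw [hh, hh]
    rfl
  · choose h hh using fun (v : KEP.VertexPath A) (hv : KEP.lastZero B v = 0)
      (hv₁ : KEP.maxA v = ⊤) => KEP.exists_homeomorph_circle hB hv hv₁
    refine ⟨h, hh, fun v hv hv₁ =>
      ⟨KEP.lastZero_shift_eq_zero hv, KEP.maxA_shift_eq_top hv₁, fun z => ?_⟩⟩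
    -- Every point of the fibre is the class of a path, and on classes both sides have explicit
    -- formulas.
    obtain ⟨x, rfl⟩ := KEP.isQuotientMap_toJ.surjective z
    rw [hh, ← KEP.toCircle_shift]
    exact hh _ _ _ x.shift
  · intro v hv hA
    have := KEP.subsingleton_fib hB hreg hv hA
    have := KEP.subsingleton_fibJ hB hreg hv hA
    obtain ⟨x, hx⟩ := KEP.proj_surjective v
    obtain ⟨z, hz⟩ := KEP.projJ_surjective (B := B) v
    exact ⟨⟨x, hx, fun y hy => congrArg Subtype.val (Subsingleton.elim
        (⟨y, hy⟩ : KEP.Fib v) ⟨x, hx⟩)⟩,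
      ⟨z, hz, fun y hy => congrArg Subtype.val (Subsingleton.elim
        (⟨y, hy⟩ : KEP.FibJ B v) ⟨z, hz⟩)⟩⟩
  · choose h hh using fun (K : ℕ) (v : KEP.VertexPath A) (hv : KEP.lastZero B v = K) =>
      KEP.exists_homeomorph_prod hB hreg hv
    refine ⟨h, fun K v hv => ⟨KEP.lastZero_shift_iterate hv, fun x => ?_⟩, fun K v hv =>
      ⟨KEP.lastZero_shift hv, fun z => ?_⟩⟩
    · rw [hh]
      exact ⟨rfl, rfl⟩
    · obtain ⟨x, rfl⟩ := KEP.isQuotientMap_toJ.surjective z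
      rw [hh]
      exact hh _ _ _ x.shift
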